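/- **Setting.** Let $N\cong\mathbb Z^n$ be a lattice, $M=N^*$, and let $\Delta=(\Sigma,C,w)$ be a simplicial multi-fan in $N$: $\Sigma$ is a finite augmented simplicial complex (so $\emptyset\in\Sigma$) with vertex set $\Sigma^{(1)}$, $\Sigma^{(k)}$ is its set of simplices with $k$ vertices, every $J\in\Sigma$ is contained in some $I\in\Sigma^{(n)}$; $C$ assigns to $J\in\Sigma^{(k)}$ a $k$-dimensional strongly convex rational polyhedral cone in $N_{\mathbb R}$, such that for each $I\in\Sigma$ it restricts to an isomorphism of ordered sets from $\{J\mid J\subset I\}$ onto the faces of $C(I)$; and $w:\Sigma^{(n)}\to\mathbb Z$ is any function. For $K\in\Sigma^{(k)}$ let $N_K$ be the smallest saturated sublattice of $N$ containing $N\cap C(K)$, let $\Sigma_K^{(n-k)}=\{I\in\Sigma^{(n)}\mid K\subset I\}$, and for $K\subset J\in\Sigma$ let $C_K(J)$ be the image of $C(J)$ in $(N/N_K)\otimes\mathbb R$. Assume that $\Delta$ is complete: for every $K\in\Sigma$ the integer $\sum_{I\in\Sigma_K^{(n-k)},\,v\in C_K(I)}w(I)$ is the same for all $v\in(N/N_K)\otimes\mathbb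 R$ that lie in no linear subspace spanned by a cone $C_K(J)$ of dimension less than $n-k$. Fix non-zero, not necessarily primitive, edge vectors $\mathcal V=\{v_i\}_{i\in\Sigma^{(1)}}$, $v_i\in N\cap C(\{i\})$. For $I\in\Sigma^{(n)}$ let $\{u_i^I\}_{i\in I}\subset M_{\mathbb Q}$ be the basis dual to $\{v_i\}_{i\in I}$. For $K\in\Sigma$ let $N_{K,\mathcal V}$ be generated by the $v_i$, $i\in K$, put $H_K=N_K/N_{K,\mathcal V}$, and let $G_K\subset\mathbb R^{\Sigma^{(1)}}/\mathbb Z^{\Sigma^{(1)}}$ be the group of classes of the $a$ with $\sum_ia_iv_i\in N$ and $a_j=0$ for $j\notin K$. Put $G_\Delta=\bigcup_{I\in\Sigma^{(n)}}G_I$, $G_{\Delta_K}=\bigcup_{I\in\Sigma_K^{(n-k)}}G_I$, $\chi_i(g)=e^{2\pi\sqrt{-1}\,g_i}$, and let $\Sigma_K'^{(1)}$ be the set of $i\notin K$ with $K\cup\{i\}\in\Sigma$. Let $H_T^{**}(\Delta,\mathcal V)$ be the ring of formal power series in the $x_i$ ($i\in\Sigma^{(1)}$) modulo the ideal generated by the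 $x_J=\prod_{i\in J}x_i$ with $J\notin\Sigma$, and $H_T^{**}(pt)$ the completed symmetric algebra of $M$ (both with rational coefficients, embedded in complex ones). The equivariant Todd classes are $$\mathcal T_T(\Delta,\mathcal V)=\sum_{g\in G_\Delta}\prod_{i\in\Sigma^{(1)}}\frac{x_i}{1-\chi_i(g)e^{-x_i}},\qquad \mathcal T_T(\Delta,\mathcal V)_K=\sum_{g\in G_{\Delta_K}}\prod_{i\in\Sigma_K'^{(1)}}\frac{x_i}{1-\chi_i(g)e^{-x_i}} .$$ For $I\in\Sigma^{(n)}$ let $\iota_I^*:H_T^{**}(\Delta,\mathcal V)\to H_T^{**}(pt)$ be the homomorphism with $x_i\mapsto u_i^I$ for $i\in I$ and $x_i\mapsto 0$ for $i\notin I$. Put $$\pi_*(x)=\sum_{I\in\Sigma^{(n)}}\frac{w(I)\,\iota_I^*(x)}{|H_I|\prod_{i\in I}u_i^I},$$ and let $p_*(x)$ be the degree-zero term of $\pi_*(x)\in H_T^{**}(pt)$. Let $\xi=\sum_id_ix_i$, $d_i\in\mathbb Z$, be $T$-Cartier, that is, $\iota_I^*(\xi)\in M$ for all $I\in\Sigma^{(n)}$.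 Fix $0<\epsilon<1$. For $K\in\Sigma$ put $$A_K^*=\{u\in M_{\mathbb R}\mid\langle u,v_i\rangle=d_i\ (i\in K)\},\qquad \xi_{K+}=\sum_{i\in K}d_ix_i+\sum_{i\in\Sigma_K'^{(1)}}(d_i+\epsilon)x_i .$$ Take $v\in N_{\mathbb R}$ with $\langle u_i^I,v\rangle\ne0$ for all $I\in\Sigma_K^{(n-k)}$, $i\in I\setminus K$. The Duistermaat–Heckman function is $$\mathrm{DH}_{\mathcal P_K(\xi_{K+})}=\sum_{I\in\Sigma_K^{(n-k)}}(-1)^{\#\{j\in I\setminus K\mid\langle u_j^I,v\rangle>0\}}\,w(I)\,\phi_I,$$ where $\phi_I$ is the characteristic function of the cone with apex $\iota_I^*(\xi_{K+})$ spanned by the vectors $\mathrm{sign}(\langle u_i^I,v\rangle)\,u_i^I$, $i\in I\setminus K$. Put $\#(\mathcal P(\xi)_K)=\sum_{u\in A_K^*\cap M}\mathrm{DH}_{\mathcal P_K(\xi_{K+})}(u)$. For $K=\emptyset$ write $\xi_+=\sum_i(d_i+\epsilon)x_i$, $\mathcal P(\xi_+)$ and $\#(\mathcal P(\xi))$. **Proposition.**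 For every such $v$ (and every $\epsilon$) the sums below have only finitely many non-zero terms, and $$\pi_*\bigl(e^\xi\,\mathcal T_T(\Delta,\mathcal V)\bigr)=\sum_{u\in M}\mathrm{DH}_{\mathcal P(\xi_+)}(u)\,e^u,\qquad p_*\bigl(e^\xi\,\mathcal T_T(\Delta,\mathcal V)\bigr)=\#(\mathcal P(\xi)).$$ More generally, for every $K\in\Sigma$, with $x_K=\prod_{i\in K}x_i$, $$\pi_*\bigl(e^\xi x_K\,\mathcal T_T(\Delta,\mathcal V)_K\bigr)=\sum_{u\in A_K^*\cap M}\mathrm{DH}_{\mathcal P_K(\xi_{K+})}(u)\,e^u,\qquad p_*\bigl(e^\xi x_K\,\mathcal T_T(\Delta,\mathcal V)_K\bigr)=\#(\mathcal P(\xi)_K).$$ -/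

import Mathlib

noncomputable section

/-- The vector of `N_ℝ = ℝⁿ` (or of `M_ℝ = ℝⁿ`) given by a vector of the lattice `N = ℤⁿ`
(or of the dual lattice `M = ℤⁿ`).  The pairing of `M_ℝ` and `N_ℝ` is the dot product `⬝ᵥ`. -/
def latVec {n : ℕ} (z : Fin n → ℤ) : Fin n → ℝ := fun j => (z j : ℝ)

/-- A simplicial multi-fan `Δ = (Σ, C, w)` in the lattice `N = ℤⁿ`, with vertex set `ι = Σ⁽¹⁾`.
The values of `cone` outside `Σ`, and those of `w` outside `Σ⁽ⁿ⁾`, play no role. -/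
structure MultiFan (ι : Type*) [Fintype ι] [DecidableEq ι] (n : ℕ) where
  /-- the augmented simplicial complex `Σ` -/
  faces : Finset (Finset ι)
  empty_mem : ∅ ∈ faces
  singleton_mem : ∀ i, {i} ∈ faces
  down_closed : ∀ I ∈ faces, ∀ J, J ⊆ I → J ∈ faces
  /-- every simplex is contained in some `I ∈ Σ⁽ⁿ⁾` -/
  exists_facet : ∀ J ∈ faces, ∃ I ∈ faces, J ⊆ I ∧ I.card = n
  /-- the map `C` -/
  cone : Finset ι → PointedCone ℝ (Fin n → ℝ)
  /-- `C(J)` is a rational polyhedral cone -/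
  cone_rational : ∀ J ∈ faces, ∃ S : Finset (Fin n → ℤ),
    cone J = PointedCone.hull ℝ (latVec '' (S : Set (Fin n → ℤ)))
  /-- `C(J)` is strongly convex -/
  cone_salient : ∀ J ∈ faces, (cone J : ConvexCone ℝ (Fin n → ℝ)).Salient
  /-- `C(J)` is `k`-dimensional for `J ∈ Σ⁽ᵏ⁾` -/
  cone_dim : ∀ J ∈ faces,
    Module.finrank ℝ (Submodule.span ℝ (cone J : Set (Fin n → ℝ))) = J.card
  /-- if `J` is a face of `I`, then `C(J)` is a face of `C(I)` -/
  cone_face : ∀ I ∈ faces, ∀ J, J ⊆ I → (cone J).IsFaceOf (cone I)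
  /-- every face of `C(I)` is some `C(J)` with `J ⊆ I` -/
  cone_face_surj : ∀ I ∈ faces, ∀ F : PointedCone ℝ (Fin n → ℝ), F.IsFaceOf (cone I) →
    ∃ J, J ⊆ I ∧ cone J = F
  /-- `C` is an isomorphism of ordered sets of `{J | J ⊆ I}` onto its image -/
  cone_le_iff : ∀ I ∈ faces, ∀ J J', J ⊆ I → J' ⊆ I → (cone J ≤ cone J' ↔ J ⊆ J')
  /-- the weight function -/
  w : Finset ι → ℤ

namespace MultiFan

variable {ι : Type*} [Fintype ι] [DecidableEq ι] {n : ℕ}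

/-- `Σ⁽ⁿ⁾` -/
def facets (Δ : MultiFan ι n) : Finset (Finset ι) := Δ.faces.filter fun I => I.card = n

/-- `Σ_K⁽ⁿ⁻ᵏ⁾`, that is, the `I ∈ Σ⁽ⁿ⁾` with `K ⊆ I` -/
def facetsAt (Δ : MultiFan ι n) (K : Finset ι) : Finset (Finset ι) :=
  Δ.facets.filter fun I => K ⊆ I

/-- `Σ'_K⁽¹⁾`, the vertices of the link of `K` in `Σ` -/
def linkVertices (Δ : MultiFan ι n) (K : Finset ι) : Finset ι :=
  Finset.univ.filter fun i => i ∉ K ∧ insert i K ∈ Δ.faces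

/-! ### Projected multi-fans and completeness -/

/-- `N^K ⊗ ℝ`, where `N^K = N / N_K`; here `N_K ⊗ ℝ` is the linear span of `C(K)`. -/
abbrev QuotSpace (Δ : MultiFan ι n) (K : Finset ι) : Type :=
  (Fin n → ℝ) ⧸ Submodule.span ℝ (Δ.cone K : Set (Fin n → ℝ))

/-- The cone `C_K(J)` of the projected multi-fan `Δ_K`: the image of `C(J)` in `N^K ⊗ ℝ`. -/
def projCone (Δ : MultiFan ι n) (K J : Finset ι) : PointedCone ℝ (Δ.QuotSpace K) :=
  (Δ.cone J).map (Submodule.mkQ (Submodule.span ℝ (Δ.cone K : Set (Fin n → ℝ))))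

/-- `v ∈ N^K ⊗ ℝ` is generic for `Δ_K`: it lies on no linear subspace spanned by a cone `C_K(J)`
whose dimension `|J| - |K|` is less than the rank `n - |K|` of `N^K`. -/
def IsGenericVec (Δ : MultiFan ι n) (K : Finset ι) (v : Δ.QuotSpace K) : Prop :=
  ∀ J ∈ Δ.faces, K ⊆ J → J.card < n →
    v ∉ Submodule.span ℝ (Δ.projCone K J : Set (Δ.QuotSpace K))

open Classical in
/-- The integer `d_v = ∑ w(I)`, over the `I ∈ Σ_K⁽ⁿ⁻ᵏ⁾` with `v ∈ C_K(I)`. -/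
def degAt (Δ : MultiFan ι n) (K : Finset ι) (v : Δ.QuotSpace K) : ℤ :=
  ∑ I ∈ (Δ.facetsAt K).filter (fun I => v ∈ Δ.projCone K I), Δ.w I

/-- The projected multi-fan `Δ_K` is pre-complete. -/
def IsPrecompleteAt (Δ : MultiFan ι n) (K : Finset ι) : Prop :=
  ∀ v v' : Δ.QuotSpace K, Δ.IsGenericVec K v → Δ.IsGenericVec K v' → Δ.degAt K v = Δ.degAt K v'

/-- The multi-fan `Δ` is complete: all its projected multi-fans are pre-complete. -/
def IsComplete (Δ : MultiFan ι n) : Prop := ∀ K ∈ Δ.faces, Δ.IsPrecompleteAt K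

/-! ### The completed equivariant cohomology ring

Rational coefficients are embedded in `ℂ`, so that the roots of unity in the equivariant Todd class
make sense. -/

/-- The ideal generated by the monomials `x_K = ∏_{i ∈ K} x_i`, `K ∉ Σ`. -/
def srIdeal (Δ : MultiFan ι n) : Ideal (MvPowerSeries ι ℂ) :=
  Ideal.span {f | ∃ K : Finset ι, K ∉ Δ.faces ∧ f = ∏ i ∈ K, MvPowerSeries.X i}

/-- The completed Stanley–Reisner ring `H_T^{**}(Δ)`. -/
abbrev HT (Δ : MultiFan ι n) : Type _ := MvPowerSeries ι ℂ ⧸ Δ.srIdeal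

/-- The class in `H_T^{**}(Δ)` of a formal power series in the `x_i`. -/
abbrev toHT (Δ : MultiFan ι n) : MvPowerSeries ι ℂ →+* Δ.HT := Ideal.Quotient.mk Δ.srIdeal

/-- `x_K = ∏_{i ∈ K} x_i` -/
def xK (Δ : MultiFan ι n) (K : Finset ι) : Δ.HT :=
  ∏ i ∈ K, Δ.toHT (MvPowerSeries.X i)

/-- `e^ξ` for `ξ = ∑ d_i x_i` -/
def expXi (Δ : MultiFan ι n) (d : ι → ℤ) : Δ.HT :=
  Δ.toHT (PowerSeries.subst
    (∑ i, MvPowerSeries.C (d i : ℂ) * MvPowerSeries.X i : MvPowerSeries ι ℂ) (PowerSeries.exp ℂ))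

/-- A set `𝒱 = {v_i}` of prescribed (not necessarily primitive) edge vectors:
`0 ≠ v_i ∈ N ∩ C(i)`. -/
structure EdgeVectors (Δ : MultiFan ι n) where
  vec : ι → Fin n → ℤ
  vec_ne_zero : ∀ i, vec i ≠ 0
  vec_mem : ∀ i, latVec (vec i) ∈ Δ.cone {i}

end MultiFan

/-- `H_T^{**}(pt)`: the formal power series ring on the standard basis of `M = ℤⁿ`. -/
abbrev HPt (n : ℕ) : Type := MvPowerSeries (Fin n) ℂ

instance HPt.instIsDomain (n : ℕ) : IsDomain (MvPowerSeries (Fin n) ℂ) :=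
  NoZeroDivisors.to_isDomain _

/-- The element of `H_T^{**}(pt)` of degree two given by `u ∈ M_ℝ`. -/
def linForm {n : ℕ} (u : Fin n → ℝ) : HPt n :=
  ∑ j, MvPowerSeries.C ((u j : ℝ) : ℂ) * MvPowerSeries.X j

/-- `e^u ∈ H_T^{**}(pt)` for `u ∈ M` -/
def expM {n : ℕ} (u : Fin n → ℤ) : HPt n :=
  PowerSeries.subst (linForm (latVec u)) (PowerSeries.exp ℂ)

/-- The power series `x / (1 - χ e^{-x})`. For `χ = 1` the denominator is divided by `x`; for
`χ ≠ 1` it is invertible. -/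
def toddSeries (χ : ℂ) : PowerSeries ℂ :=
  open Classical in
  if χ = 1 then
    (PowerSeries.mk fun k =>
      PowerSeries.coeff (k + 1) (1 - PowerSeries.evalNegHom (PowerSeries.exp ℂ)))⁻¹
  else
    PowerSeries.X * (1 - PowerSeries.C χ * PowerSeries.evalNegHom (PowerSeries.exp ℂ))⁻¹

/-- The defining property of `x / (1 - χ e^{-x})`. -/
theorem toddSeries_mul (χ : ℂ) :
    toddSeries χ * (1 - PowerSeries.C χ * PowerSeries.evalNegHom (PowerSeries.exp ℂ))
      = PowerSeries.X := by
  have hc : PowerSeries.constantCoeff (PowerSeries.evalNegHom (PowerSeries.exp ℂ)) = 1 := by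
    rw [← PowerSeries.coeff_zero_eq_constantCoeff_apply]
    simp [PowerSeries.evalNegHom, PowerSeries.coeff_rescale]
  unfold toddSeries
  split_ifs with h
  · subst h
    set E : PowerSeries ℂ := 1 - PowerSeries.evalNegHom (PowerSeries.exp ℂ) with hE
    have h1 : E = PowerSeries.X * PowerSeries.mk fun k => PowerSeries.coeff (k + 1) E := by
      ext k
      cases k with
      | zero => simp [hE, hc]
      | succ k => simp [PowerSeries.coeff_succ_X_mul]
    have h2 : PowerSeries.constantCoeff (PowerSeries.mk fun k => PowerSeries.coeff (k + 1) E) ≠ 0 := by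
      rw [← PowerSeries.coeff_zero_eq_constantCoeff_apply]
      simp [hE, PowerSeries.evalNegHom, PowerSeries.coeff_rescale, PowerSeries.coeff_one]
    have h3 : (1 : PowerSeries ℂ) - PowerSeries.C 1 *
        PowerSeries.evalNegHom (PowerSeries.exp ℂ) = E := by simp [hE]
    rw [h3]
    nth_rewrite 2 [h1]
    rw [mul_left_comm, PowerSeries.inv_mul_cancel _ h2, mul_one]
  · rw [mul_assoc, PowerSeries.inv_mul_cancel, mul_one]
    simp only [map_sub, map_one, map_mul, hc, PowerSeries.constantCoeff_C, mul_one]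
    exact sub_ne_zero.mpr (Ne.symm h)

namespace MultiFan.EdgeVectors

variable {ι : Type*} [Fintype ι] [DecidableEq ι] {n : ℕ} {Δ : MultiFan ι n}

/-- For `I ∈ Σ⁽ⁿ⁾` and `i ∈ I`, the element `u_i^I ∈ M_ℚ ⊆ M_ℝ` of the basis dual to `{v_j}_{j ∈ I}`:
the unique `u` with `⟨u, v_j⟩ = δ_{ij}` for `j ∈ I`. -/
def dualVec (V : Δ.EdgeVectors) (I : Finset ι) (i : ι) : Fin n → ℝ :=
  Classical.epsilon fun u : Fin n → ℝ =>
    ∀ j ∈ I, u ⬝ᵥ latVec (V.vec j) = if j = i then 1 else 0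

/-- `u_I = ι_I^*(ξ) = ∑_{i ∈ I} d_i u_i^I` for `ξ = ∑ d_i x_i` -/
def vertexPt (V : Δ.EdgeVectors) (d : ι → ℝ) (I : Finset ι) : Fin n → ℝ :=
  ∑ i ∈ I, d i • V.dualVec I i

/-- `ξ = ∑ d_i x_i` is `T`-Cartier: `ι_I^*(ξ) ∈ M` for all `I ∈ Σ⁽ⁿ⁾`. -/
def IsTCartier (V : Δ.EdgeVectors) (d : ι → ℤ) : Prop :=
  ∀ I ∈ Δ.facets, ∃ m : Fin n → ℤ, V.vertexPt (fun i => (d i : ℝ)) I = latVec m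

/-! ### The groups `H_K` and `G_K` -/

/-- `N_K`, the smallest saturated sublattice of `N` containing `N ∩ C(K)`. -/
def satLattice (_V : Δ.EdgeVectors) (K : Finset ι) : AddSubgroup (Fin n → ℤ) where
  carrier := {z | latVec z ∈ Submodule.span ℝ (Δ.cone K : Set (Fin n → ℝ))}
  zero_mem' := by
    have h : latVec (0 : Fin n → ℤ) = 0 := by ext j; simp [latVec]
    simp [h]
  add_mem' := by
    intro a b ha hb
    have h : latVec (a + b) = latVec a + latVec b := by ext j; simp [latVec]
    simp only [Set.mem_ofPred_eq] at ha hb ⊢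
    rw [h]
    exact add_mem ha hb
  neg_mem' := by
    intro a ha
    have h : latVec (-a) = -latVec a := by ext j; simp [latVec]
    simp only [Set.mem_ofPred_eq] at ha ⊢
    rw [h]
    exact neg_mem ha

/-- `N_{K,𝒱}`, the sublattice generated by the `v_i`, `i ∈ K`. -/
def edgeLattice (V : Δ.EdgeVectors) (K : Finset ι) : AddSubgroup (Fin n → ℤ) :=
  AddSubgroup.closure (V.vec '' (K : Set ι))

/-- `H_{K,𝒱} = N_K / N_{K,𝒱}` -/
abbrev H (V : Δ.EdgeVectors) (K : Finset ι) : Type :=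
  V.satLattice K ⧸ (V.edgeLattice K).addSubgroupOf (V.satLattice K)

/-- `G_K ⊆ ℝ^{Σ⁽¹⁾} / ℤ^{Σ⁽¹⁾}`: the classes of the `a` with `∑ a_i v_i ∈ N` and `a_j = 0` for
`j ∉ K`. -/
def G (V : Δ.EdgeVectors) (K : Finset ι) : Set (ι → UnitAddCircle) :=
  {g | ∃ a : ι → ℝ, (∃ z : Fin n → ℤ, ∑ i, a i • latVec (V.vec i) = latVec z) ∧
    (∀ j, j ∉ K → a j = 0) ∧ g = fun i => (a i : UnitAddCircle)}

/-- `G_Δ = ⋃_{I ∈ Σ⁽ⁿ⁾} G_I` -/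
def GDelta (V : Δ.EdgeVectors) : Set (ι → UnitAddCircle) := ⋃ I ∈ Δ.facets, V.G I

/-- `G_{Δ_K} = ⋃_{I ∈ Σ_K⁽ⁿ⁻ᵏ⁾} G_I` -/
def GDeltaAt (V : Δ.EdgeVectors) (K : Finset ι) : Set (ι → UnitAddCircle) :=
  ⋃ I ∈ Δ.facetsAt K, V.G I

end MultiFan.EdgeVectors

/-- `χ_i(g) = e^{2π√-1 g_i}` -/
def chiAt {ι : Type*} (g : ι → UnitAddCircle) (i : ι) : ℂ := (AddCircle.toCircle (g i) : ℂ)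

namespace MultiFan.EdgeVectors

variable {ι : Type*} [Fintype ι] [DecidableEq ι] {n : ℕ} {Δ : MultiFan ι n}

/-- The equivariant Todd class
`𝒯_T(Δ,𝒱) = ∑_{g ∈ G_Δ} ∏_{i ∈ Σ⁽¹⁾} x_i / (1 - χ_i(g) e^{-x_i})`. -/
def toddClass (V : Δ.EdgeVectors) : Δ.HT :=
  ∑ᶠ g ∈ V.GDelta, ∏ i,
    Δ.toHT (PowerSeries.subst (MvPowerSeries.X i : MvPowerSeries ι ℂ) (toddSeries (chiAt g i)))

/-- `𝒯_T(Δ,𝒱)_K = ∑_{g ∈ G_{Δ_K}} ∏_{i ∈ Σ'_K⁽¹⁾} x_i / (1 - χ_i(g) e^{-x_i})`. -/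
def toddClassAt (V : Δ.EdgeVectors) (K : Finset ι) : Δ.HT :=
  ∑ᶠ g ∈ V.GDeltaAt K, ∏ i ∈ Δ.linkVertices K,
    Δ.toHT (PowerSeries.subst (MvPowerSeries.X i : MvPowerSeries ι ℂ) (toddSeries (chiAt g i)))

/-! ### Restriction maps and push-forward -/

/-- The values of `ι_I^*` on the generators: `x_i ↦ u_i^I` for `i ∈ I`, `x_i ↦ 0` for `i ∉ I`. -/
def restrictGen (V : Δ.EdgeVectors) (I : Finset ι) (i : ι) : HPt n :=
  if i ∈ I then linForm (V.dualVec I i) else 0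

theorem hasSubst_restrictGen (V : Δ.EdgeVectors) (I : Finset ι) :
    MvPowerSeries.HasSubst (V.restrictGen I) := by
  apply MvPowerSeries.hasSubst_of_constantCoeff_zero
  intro i
  unfold restrictGen
  split_ifs <;> simp [linForm]

/-- The restriction homomorphism `ι_I^* : H_T^{**}(Δ,𝒱) → H_T^{**}(pt)`. -/
def restrict (V : Δ.EdgeVectors) (I : Finset ι) (hI : I ∈ Δ.facets) : Δ.HT →+* HPt n :=
  Ideal.Quotient.lift Δ.srIdeal
    ((MvPowerSeries.substAlgHom (R := ℂ) (V.hasSubst_restrictGen I) :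
      MvPowerSeries ι ℂ →ₐ[ℂ] HPt n) : MvPowerSeries ι ℂ →+* HPt n) (by
      intro a ha
      refine (Ideal.span_le (I := RingHom.ker
        ((MvPowerSeries.substAlgHom (R := ℂ) (V.hasSubst_restrictGen I) :
          MvPowerSeries ι ℂ →ₐ[ℂ] HPt n) : MvPowerSeries ι ℂ →+* HPt n))).mpr ?_ ha
      rintro f ⟨K, hK, rfl⟩
      have hsub : ¬ K ⊆ I := fun h =>
        hK (Δ.down_closed I (Finset.mem_filter.mp hI).1 K h)
      obtain ⟨i, hiK, hiI⟩ := Finset.not_subset.mp hsub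
      simp only [SetLike.mem_coe, RingHom.mem_ker, RingHom.coe_coe, map_prod]
      refine Finset.prod_eq_zero hiK ?_
      rw [MvPowerSeries.substAlgHom_X]
      simp [restrictGen, hiI])

/-- The push-forward `π_*(x) = ∑_{I ∈ Σ⁽ⁿ⁾} w(I) ι_I^*(x) / (|H_I| ∏_{i ∈ I} u_i^I)`. Its values lie
in `S⁻¹H_T^{**}(pt)`, `S` being generated by the non-zero elements of `M_ℚ`; this ring is seen in
the fraction field. -/
def push (V : Δ.EdgeVectors) (x : Δ.HT) : FractionRing (HPt n) :=
  ∑ I : {I // I ∈ Δ.facets},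
    (algebraMap (HPt n) (FractionRing (HPt n)) ((Δ.w I.1 : HPt n) * V.restrict I.1 I.2 x)) /
      (algebraMap (HPt n) (FractionRing (HPt n))
        ((Nat.card (V.H I.1) : HPt n) * ∏ i ∈ I.1, linForm (V.dualVec I.1 i)))

open Classical in
/-- `p_*(x)`: the constant term of `π_*(x)`, whenever `π_*(x)` lies in `H_T^{**}(pt)` (for complete
`Δ` this is always so); the value is `0` otherwise. -/
def pushPt (V : Δ.EdgeVectors) (x : Δ.HT) : ℂ :=
  if h : ∃ f : HPt n, algebraMap (HPt n) (FractionRing (HPt n)) f = V.push x then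
    MvPowerSeries.constantCoeff h.choose
  else 0

/-! ### The Duistermaat–Heckman function -/

/-- `v` is generic with respect to `K`: `⟨u_i^I, v⟩ ≠ 0` for `I ∈ Σ_K⁽ⁿ⁻ᵏ⁾`, `i ∈ I \ K`. As these
`u_i^I` annihilate `N_K`, this is a condition on the image of `v` in `N^K ⊗ ℝ`. -/
def IsGeneric (V : Δ.EdgeVectors) (K : Finset ι) (v : Fin n → ℝ) : Prop :=
  ∀ I ∈ Δ.facetsAt K, ∀ i ∈ I \ K, V.dualVec I i ⬝ᵥ v ≠ 0

/-- `(-1)^I` -/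
def signAt (V : Δ.EdgeVectors) (K : Finset ι) (v : Fin n → ℝ) (I : Finset ι) : ℤ :=
  open Classical in
  (-1) ^ ((I \ K).filter fun j => 0 < V.dualVec I j ⬝ᵥ v).card

/-- `(u_i^I)⁺` -/
def dualVecPos (V : Δ.EdgeVectors) (v : Fin n → ℝ) (I : Finset ι) (i : ι) : Fin n → ℝ :=
  open Classical in
  if 0 < V.dualVec I i ⬝ᵥ v then V.dualVec I i else -V.dualVec I i

/-- `C_K^*(I)⁺`, the cone with apex `u_I` spanned by the `(u_i^I)⁺`, `i ∈ I \ K`. -/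
def dualConePos (V : Δ.EdgeVectors) (K : Finset ι) (d : ι → ℝ) (v : Fin n → ℝ) (I : Finset ι) :
    Set (Fin n → ℝ) :=
  {u | ∃ c : ι → ℝ, (∀ i, 0 ≤ c i) ∧
    u = V.vertexPt d I + ∑ i ∈ I \ K, c i • V.dualVecPos v I i}

/-- The Duistermaat–Heckman function of the multi-polytope `𝒫_K(∑ d_i x_i)`, computed with the
generic vector `v`. -/
def DH (V : Δ.EdgeVectors) (K : Finset ι) (d : ι → ℝ) (v : Fin n → ℝ) (u : Fin n → ℝ) : ℤ :=
  open Classical in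
  ∑ I ∈ Δ.facetsAt K,
    if u ∈ V.dualConePos K d v I then V.signAt K v I * Δ.w I else 0

/-- `A_K^* ∩ M`, where `A_K^* = {u | ⟨u, v_i⟩ = d_i for i ∈ K}`. -/
def affLattice (V : Δ.EdgeVectors) (K : Finset ι) (d : ι → ℤ) : Set (Fin n → ℤ) :=
  {u | ∀ i ∈ K, latVec u ⬝ᵥ latVec (V.vec i) = (d i : ℝ)}

/-- The coefficients of `ξ_{K+}`: `d_i` for `i ∈ K`, and `d_i + ε` for all other `i`. For `K = ∅`
this is `ξ_+`. -/
def shift (_V : Δ.EdgeVectors) (K : Finset ι) (d : ι → ℤ) (ε : ℝ) (i : ι) : ℝ :=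
  if i ∈ K then (d i : ℝ) else (d i : ℝ) + ε

/-- `#(𝒫(ξ)_K) = ∑_{u ∈ A_K^* ∩ M} DH_{𝒫_K(ξ_{K+})}(u)`. -/
def latticeCount (V : Δ.EdgeVectors) (K : Finset ι) (d : ι → ℤ) (ε : ℝ) (v : Fin n → ℝ) : ℤ :=
  ∑ᶠ u ∈ V.affLattice K d, V.DH K (V.shift K d ε) v (latVec u)

/-- `∑_{u ∈ A_K^* ∩ M} DH_{𝒫_K(ξ_{K+})}(u) e^u ∈ H_T^{**}(pt)`. -/
def latticeSeries (V : Δ.EdgeVectors) (K : Finset ι) (d : ι → ℤ) (ε : ℝ) (v : Fin n → ℝ) : HPt n :=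
  ∑ᶠ u ∈ V.affLattice K d, (V.DH K (V.shift K d ε) v (latVec u)) • expM u

end MultiFan.EdgeVectors

end

noncomputable section

/-! ### Linear algebra of lattice vectors -/

/-! At a facet I containing K, restriction kills every summand of the Todd class except those with g
in G_I, and the contribution to the push-forward is w(I)/|H_I| times the sum over g of e^{u_I} ∏
1/(1 − χ_i(g) e^{−u_i}), with i in I \ K. Formally, each factor can be expanded as a geometric
series in e^{−u_i} or in e^{u_i}. Averaging over g keeps exactly the exponents in M, so the
contribution becomes a signed sum of e^u over the lattice points of a cone at u_I. The direction of
expansion is dictated by the sign of ⟨u_i, v⟩, and the shift by ε decides which boundary points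
belong to the cone. Summing over I gives the Duistermaat–Heckman function.

These series have infinite support and do not live in `HPt`, so the proof compares both sides after
clearing denominators. Choose N with N u_i in M. On the Todd side, multiplying by ∏ (1 − e^{−N u_i})
leaves finite geometric sums, and orthogonality of characters (`sum_prod_chiAt_pow`) turns them into
the exponential sum of a half-open box (`restrict_mul_prod_one_sub`, `bijOn_boxSet`). On the
function side, the same element of ℂ[M] acts as a difference operator and sends the signed cone
function to the indicator of the same box, whatever v is (`latticeAction_cone`). The passage f ↦ ∑
f(u) e^u is ℂ[M]-linear on finitely supported functions (`expSum_latticeAction`). If the total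
function has finite support, the two sides therefore agree after multiplication by a non-zero
element of a domain, hence agree (`push_eq_expSum`).

Finite support is where completeness enters. Whether u lies in the cone of I is read as whether v
lies in a cone on reflected edge vectors. Following a ray v − t p, `ray_crossing_identity` replaces
membership by signed crossings of walls. Whether a wall is crossed depends on the wall alone, and
the weighted signs of the facets around it cancel (`sum_sign_eq_zero`). Only the requirement that
the ray leave every cone must be ensured, and it holds when u is separated from all vertices
(`DH_eq_zero`). For large u, the functional u itself separates. -/

@[simp] theorem latVec_zero {n : ℕ} : latVec (0 : Fin n → ℤ) = 0 := by
  ext j; simp [latVec]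

theorem latVec_add {n : ℕ} (a b : Fin n → ℤ) : latVec (a + b) = latVec a + latVec b := by
  ext j; simp [latVec]

theorem latVec_neg {n : ℕ} (a : Fin n → ℤ) : latVec (-a) = -latVec a := by
  ext j; simp [latVec]

theorem latVec_injective {n : ℕ} : Function.Injective (latVec (n := n)) := by
  intro a b h
  ext j
  have := congrFun h j
  simpa [latVec] using this

theorem latVec_dotProduct {n : ℕ} (a b : Fin n → ℤ) :
    latVec a ⬝ᵥ latVec b = ((a ⬝ᵥ b : ℤ) : ℝ) := by
  simp [latVec, dotProduct]

theorem latVec_smul {n : ℕ} (k : ℤ) (a : Fin n → ℤ) : latVec (k • a) = (k : ℝ) • latVec a := by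
  ext j; simp [latVec]

theorem latVec_sum {n : ℕ} {κ : Type*} (s : Finset κ) (f : κ → Fin n → ℤ) :
    latVec (∑ i ∈ s, f i) = ∑ i ∈ s, latVec (f i) := by
  ext j; simp [latVec]

/-- A face of a cone is cut out by its linear span. -/
theorem PointedCone.IsFaceOf.mem_of_mem_span {E : Type*} [AddCommGroup E] [Module ℝ E]
    {F C : PointedCone ℝ E} (h : F.IsFaceOf C) {x : E} (hx : x ∈ C)
    (hs : x ∈ Submodule.span ℝ (F : Set E)) : x ∈ F := by
  have key : ∀ y ∈ Submodule.span ℝ (F : Set E), ∃ a ∈ F, ∃ b ∈ F, y = a - b := by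
    intro y hy
    induction hy using Submodule.span_induction with
    | mem y hy => exact ⟨y, hy, 0, zero_mem _, by simp⟩
    | zero => exact ⟨0, zero_mem _, 0, zero_mem _, by simp⟩
    | add y z _ _ hy hz =>
      obtain ⟨a, ha, b, hb, rfl⟩ := hy
      obtain ⟨a', ha', b', hb', rfl⟩ := hz
      exact ⟨a + a', add_mem ha ha', b + b', add_mem hb hb', by abel⟩
    | smul c y _ hy =>
      obtain ⟨a, ha, b, hb, rfl⟩ := hy
      rcases le_total 0 c with hc | hc
      · exact ⟨c • a, F.smul_mem hc ha, c • b, F.smul_mem hc hb, smul_sub _ _ _⟩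
      · refine ⟨(-c) • b, F.smul_mem (neg_nonneg.2 hc) hb, (-c) • a,
          F.smul_mem (neg_nonneg.2 hc) ha, ?_⟩
        module
  obtain ⟨a, ha, b, hb, rfl⟩ := key x hs
  -- The sum (a − b) + b = a lies in F, so the face property puts the summand a − b in F.
  exact h.mem_of_add_mem_left hx (h.le hb) (by simpa using ha)

namespace MultiFan

variable {ι : Type*} [Fintype ι] [DecidableEq ι] {n : ℕ} {Δ : MultiFan ι n}

theorem mem_facets {I : Finset ι} : I ∈ Δ.facets ↔ I ∈ Δ.faces ∧ I.card = n := by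
  simp [facets]

theorem mem_facetsAt {K I : Finset ι} : I ∈ Δ.facetsAt K ↔ I ∈ Δ.facets ∧ K ⊆ I := by
  simp [facetsAt]

theorem facetsAt_empty : Δ.facetsAt ∅ = Δ.facets := by
  ext I; simp [mem_facetsAt]

theorem linkVertices_empty : Δ.linkVertices ∅ = Finset.univ := by
  ext i; simpa [linkVertices] using Δ.singleton_mem i

/-! ### Edge vectors of a facet as a basis, and the dual basis. -/

namespace EdgeVectors

variable (V : Δ.EdgeVectors)

theorem vec_mem_cone {J : Finset ι} (hJ : J ∈ Δ.faces) {i : ι} (hi : i ∈ J) :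
    latVec (V.vec i) ∈ Δ.cone J :=
  (Δ.cone_face J hJ {i} (by simpa using hi)).le (V.vec_mem i)

theorem latVec_vec_ne_zero (i : ι) : latVec (V.vec i) ≠ 0 := by
  intro h
  apply V.vec_ne_zero i
  apply latVec_injective
  simp [h]

/-- The ray `C(i)` is spanned by `v_i`. -/
theorem cone_singleton_le {i : ι} {C : PointedCone ℝ (Fin n → ℝ)}
    (h : latVec (V.vec i) ∈ C) : Δ.cone {i} ≤ C := by
  intro y hy
  have hd := Δ.cone_dim {i} (Δ.singleton_mem i)
  rw [Finset.card_singleton] at hd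
  have hv := V.vec_mem i
  set S := Submodule.span ℝ (Δ.cone {i} : Set (Fin n → ℝ))
  obtain ⟨c, hc⟩ := (finrank_eq_one_iff_of_nonzero' (⟨latVec (V.vec i), Submodule.subset_span hv⟩ : S)
    (by simpa [Subtype.ext_iff] using V.latVec_vec_ne_zero i)).1 hd ⟨y, Submodule.subset_span hy⟩
  have hc' : c • latVec (V.vec i) = y := congrArg Subtype.val hc
  rcases le_or_gt 0 c with h0 | h0
  · rw [← hc']; exact C.smul_mem h0 h
  · exfalso
    refine Δ.cone_salient {i} (Δ.singleton_mem i) _ hv (V.latVec_vec_ne_zero i) ?_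
    have : (-c)⁻¹ • y ∈ Δ.cone {i} := (Δ.cone {i}).smul_mem (by simpa using h0.le) hy
    rw [← hc', smul_smul, inv_neg, neg_mul, inv_mul_cancel₀ h0.ne, neg_one_smul] at this
    exact this

theorem vec_notMem_cone {I J : Finset ι} (hI : I ∈ Δ.faces) (hJ : J ⊆ I) {i : ι} (hi : i ∈ I)
    (hiJ : i ∉ J) : latVec (V.vec i) ∉ Δ.cone J := fun h =>
  hiJ (by simpa using (Δ.cone_le_iff I hI {i} J (by simpa using hi) hJ).1 (V.cone_singleton_le h))

theorem vec_notMem_span {I J : Finset ι} (hI : I ∈ Δ.faces) (hJ : J ⊆ I) {i : ι} (hi : i ∈ I)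
    (hiJ : i ∉ J) :
    latVec (V.vec i) ∉ Submodule.span ℝ (Δ.cone J : Set (Fin n → ℝ)) := fun h =>
  V.vec_notMem_cone hI hJ hi hiJ
    ((Δ.cone_face I hI J hJ).mem_of_mem_span (V.vec_mem_cone hI hi) h)

/-- Vertices are added one at a time: a new v_i lies outside the span of C(J), and this span
contains all the v_j already present. -/
theorem linearIndepOn_vec {I : Finset ι} (hI : I ∈ Δ.faces) :
    LinearIndepOn ℝ (fun i => latVec (V.vec i)) (I : Set ι) := by
  have key : ∀ J : Finset ι, J ⊆ I → LinearIndepOn ℝ (fun i => latVec (V.vec i)) (J : Set ι) := by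
    intro J
    induction J using Finset.induction_on with
    | empty => intro _; simp
    | insert i J hi ih =>
      intro hJ
      have hJ' : J ⊆ I := (Finset.subset_insert i J).trans hJ
      rw [Finset.coe_insert]
      refine (ih hJ').insert fun h => ?_
      refine V.vec_notMem_span hI hJ' (hJ (Finset.mem_insert_self i J)) hi
        (Submodule.span_mono ?_ h)
      rintro _ ⟨j, hj, rfl⟩
      exact V.vec_mem_cone (Δ.down_closed I hI J hJ') hj
  exact key I subset_rfl

/-- `C(J)` and the `v_j`, `j ∈ J`, span the same subspace. -/
theorem span_cone {J : Finset ι} (hJ : J ∈ Δ.faces) :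
    Submodule.span ℝ (Δ.cone J : Set (Fin n → ℝ)) =
      Submodule.span ℝ ((fun i => latVec (V.vec i)) '' (J : Set ι)) := by
  symm
  apply Submodule.eq_of_le_of_finrank_le
  · apply Submodule.span_mono
    rintro _ ⟨j, hj, rfl⟩
    exact V.vec_mem_cone hJ hj
  · rw [Δ.cone_dim J hJ, Set.image_eq_range]
    have := finrank_span_eq_card (V.linearIndepOn_vec hJ)
    simpa using this.ge

theorem span_vec_eq_top {I : Finset ι} (hI : I ∈ Δ.facets) :
    Submodule.span ℝ ((fun i => latVec (V.vec i)) '' (I : Set ι)) = ⊤ := by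
  obtain ⟨hI, hc⟩ := mem_facets.1 hI
  rw [← V.span_cone hI]
  apply Submodule.eq_top_of_finrank_eq
  rw [Δ.cone_dim I hI, hc]
  simp

/-- The basis `{v_i}_{i ∈ I}` of `N_ℝ`. -/
def basisOf {I : Finset ι} (hI : I ∈ Δ.facets) : Module.Basis I ℝ (Fin n → ℝ) :=
  Module.Basis.mk (v := fun i : I => latVec (V.vec i)) (V.linearIndepOn_vec (mem_facets.1 hI).1) (by
    have := V.span_vec_eq_top hI
    rw [Set.image_eq_range] at this
    exact this.ge)

@[simp] theorem basisOf_apply {I : Finset ι} (hI : I ∈ Δ.facets) (i : I) :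
    V.basisOf hI i = latVec (V.vec i) :=
  Module.Basis.mk_apply _ _ i

theorem dualVec_dotProduct {I : Finset ι} (hI : I ∈ Δ.facets) {i j : ι} (hi : i ∈ I) (hj : j ∈ I) :
    V.dualVec I i ⬝ᵥ latVec (V.vec j) = if j = i then 1 else 0 := by
  have hex : ∃ u : Fin n → ℝ, ∀ j ∈ I, u ⬝ᵥ latVec (V.vec j) = if j = i then 1 else 0 := by
    -- The witness is the i-th coordinate functional, written as the vector of its values on the
    -- standard basis.
    refine ⟨fun k => (V.basisOf hI).coord ⟨i, hi⟩ (Pi.single k 1), fun j hj => ?_⟩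
    have h1 : (fun k => (V.basisOf hI).coord ⟨i, hi⟩ (Pi.single k 1)) ⬝ᵥ latVec (V.vec j) =
        (V.basisOf hI).coord ⟨i, hi⟩ (latVec (V.vec j)) := by
      conv_rhs => rw [pi_eq_sum_univ' (latVec (V.vec j)), map_sum]
      simp only [dotProduct, map_smul, smul_eq_mul, mul_comm]
    rw [h1, ← V.basisOf_apply hI ⟨j, hj⟩, Module.Basis.coord_apply, Module.Basis.repr_self]
    simp [Finsupp.single_apply]
  exact Classical.epsilon_spec hex j hj

theorem sum_dualVec_smul {I : Finset ι} (hI : I ∈ Δ.facets) (p : Fin n → ℝ) :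
    ∑ i ∈ I, (V.dualVec I i ⬝ᵥ p) • latVec (V.vec i) = p := by
  have hp : p ∈ Submodule.span ℝ ((fun i => latVec (V.vec i)) '' (I : Set ι)) := by
    rw [V.span_vec_eq_top hI]; trivial
  induction hp using Submodule.span_induction with
  | mem x hx =>
    obtain ⟨j, hj, rfl⟩ := hx
    rw [Finset.sum_eq_single j]
    · simp [V.dualVec_dotProduct hI hj hj]
    · intro i hi hij
      simp [V.dualVec_dotProduct hI hi hj, hij.symm]
    · intro h; exact absurd hj h
  | zero => simp
  | add x y _ _ hx hy => simp only [dotProduct_add, add_smul, Finset.sum_add_distrib, hx, hy]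
  | smul c x _ hx =>
    simp only [dotProduct_smul, smul_assoc, ← Finset.smul_sum, hx]

theorem sum_smul_dualVec {I : Finset ι} (hI : I ∈ Δ.facets) (u : Fin n → ℝ) :
    ∑ i ∈ I, (u ⬝ᵥ latVec (V.vec i)) • V.dualVec I i = u := by
  refine dotProduct_eq _ _ fun p => ?_
  conv_rhs => rw [← V.sum_dualVec_smul hI p, dotProduct_sum]
  rw [sum_dotProduct]
  refine Finset.sum_congr rfl fun i _ => ?_
  rw [smul_dotProduct, dotProduct_smul, smul_eq_mul, smul_eq_mul, mul_comm]

theorem sum_smul_dualVec_dotProduct {I : Finset ι} (hI : I ∈ Δ.facets) (c : ι → ℝ) {j : ι}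
    (hj : j ∈ I) : (∑ i ∈ I, c i • V.dualVec I i) ⬝ᵥ latVec (V.vec j) = c j := by
  rw [sum_dotProduct, Finset.sum_eq_single j]
  · simp [V.dualVec_dotProduct hI hj hj]
  · intro i hi hij
    simp [V.dualVec_dotProduct hI hi hj, hij.symm]
  · intro h; exact absurd hj h

theorem dualVec_dotProduct_sum_smul {I : Finset ι} (hI : I ∈ Δ.facets) (c : ι → ℝ) {i : ι}
    (hi : i ∈ I) {J : Finset ι} (hJ : J ⊆ I) :
    V.dualVec I i ⬝ᵥ (∑ j ∈ J, c j • latVec (V.vec j)) = if i ∈ J then c i else 0 := by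
  rw [dotProduct_sum]
  have : ∀ j ∈ J, V.dualVec I i ⬝ᵥ c j • latVec (V.vec j) = if i = j then c j else 0 := by
    intro j hj
    rw [dotProduct_smul, V.dualVec_dotProduct hI hi (hJ hj)]
    simp [eq_comm]
  rw [Finset.sum_congr rfl this, Finset.sum_ite_eq]

theorem vertexPt_dotProduct {I : Finset ι} (hI : I ∈ Δ.facets) (d : ι → ℝ) {j : ι} (hj : j ∈ I) :
    V.vertexPt d I ⬝ᵥ latVec (V.vec j) = d j :=
  V.sum_smul_dualVec_dotProduct hI d hj

theorem dualVec_ne_zero {I : Finset ι} (hI : I ∈ Δ.facets) {i : ι} (hi : i ∈ I) :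
    V.dualVec I i ≠ 0 := by
  intro h
  have := V.dualVec_dotProduct hI hi hi
  simp [h] at this

/-! ### The cycle condition -/

theorem dualVec_dotProduct_of_mem_span {I J : Finset ι} (hI : I ∈ Δ.facets) (hJ : J ⊆ I) {i : ι}
    (hi : i ∈ I) (hiJ : i ∉ J) {s : Fin n → ℝ}
    (hs : s ∈ Submodule.span ℝ (Δ.cone J : Set (Fin n → ℝ))) : V.dualVec I i ⬝ᵥ s = 0 := by
  rw [V.span_cone (Δ.down_closed I (mem_facets.1 hI).1 J hJ)] at hs
  induction hs using Submodule.span_induction with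
  | mem x hx =>
    obtain ⟨j, hj, rfl⟩ := hx
    rw [V.dualVec_dotProduct hI hi (hJ hj), if_neg]
    rintro rfl; exact hiJ hj
  | zero => simp
  | add x y _ _ hx hy => rw [dotProduct_add, hx, hy, add_zero]
  | smul c x _ hx => rw [dotProduct_smul, hx, smul_zero]

/-- Modulo the span of the wall J, only the coordinate along v_i survives. The image of C(I) is a
half-line and not a line: a point of C(I) with negative coordinate, plus a positive multiple of v_i,
would land in the face C(J) and force v_i into it. -/
theorem mem_projCone_iff {I J : Finset ι} {i : ι} (hI : I ∈ Δ.facets) (hiJ : i ∉ J)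
    (hIJ : insert i J = I) (p : Fin n → ℝ) :
    (Submodule.Quotient.mk p : Δ.QuotSpace J) ∈ Δ.projCone J I ↔ 0 ≤ V.dualVec I i ⬝ᵥ p := by
  have hJ : J ⊆ I := hIJ ▸ Finset.subset_insert i J
  have hi : i ∈ I := hIJ ▸ Finset.mem_insert_self i J
  have hIf := (mem_facets.1 hI).1
  constructor
  · rintro ⟨c, hc, hcp⟩
    have hcp' : (Submodule.Quotient.mk c : Δ.QuotSpace J) = Submodule.Quotient.mk p := hcp
    rw [Submodule.Quotient.eq] at hcp'
    have h0 := V.dualVec_dotProduct_of_mem_span hI hJ hi hiJ hcp'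
    rw [dotProduct_sub, sub_eq_zero] at h0
    rw [← h0]
    by_contra! hneg
    have h1 : c + (-(V.dualVec I i ⬝ᵥ c)) • latVec (V.vec i) ∈
        Submodule.span ℝ (Δ.cone J : Set (Fin n → ℝ)) := by
      rw [V.span_cone (Δ.down_closed I hIf J hJ)]
      have := V.sum_dualVec_smul hI c
      rw [← hIJ, Finset.sum_insert hiJ, hIJ] at this
      nth_rewrite 1 [← this]
      rw [neg_smul, add_neg_cancel_comm]
      exact sum_mem fun j hj =>
        Submodule.smul_mem _ _ (Submodule.subset_span ⟨j, hj, rfl⟩)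
    have hface := Δ.cone_face I hIf J hJ
    have hvC : latVec (V.vec i) ∈ Δ.cone I := V.vec_mem_cone hIf hi
    have h2 := hface.mem_of_mem_span
      (add_mem hc ((Δ.cone I).smul_mem (by linarith : 0 ≤ -(V.dualVec I i ⬝ᵥ c)) hvC)) h1
    rw [add_comm] at h2
    exact V.vec_notMem_cone hIf hJ hi hiJ
      (hface.mem_of_smul_add_mem hvC hc (by linarith : 0 < -(V.dualVec I i ⬝ᵥ c)) h2)
  · intro h
    refine ⟨(V.dualVec I i ⬝ᵥ p) • latVec (V.vec i),
      (Δ.cone I).smul_mem h (V.vec_mem_cone hIf hi), ?_⟩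
    change (Submodule.Quotient.mk _ : Δ.QuotSpace J) = Submodule.Quotient.mk p
    rw [Submodule.Quotient.eq, V.span_cone (Δ.down_closed I hIf J hJ)]
    have := V.sum_dualVec_smul hI p
    rw [← hIJ, Finset.sum_insert hiJ, hIJ] at this
    nth_rewrite 2 [← this]
    rw [sub_add_cancel_left]
    exact neg_mem (sum_mem fun j hj =>
        Submodule.smul_mem _ _ (Submodule.subset_span ⟨j, hj, rfl⟩))

/-- Pre-completeness of the one-dimensional projected multi-fan at `J` says that the facets
containing `J`, weighted by the side of the wall on which they lie, cancel. -/
theorem sum_sign_eq_zero {J : Finset ι} (hJ : J ∈ Δ.faces) (hc : J.card + 1 = n)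
    (hpre : Δ.IsPrecompleteAt J) {p : Fin n → ℝ}
    (hp : p ∉ Submodule.span ℝ (Δ.cone J : Set (Fin n → ℝ))) :
    ∑ I ∈ Δ.facetsAt J, ∑ i ∈ I \ J, Δ.w I * (SignType.sign (V.dualVec I i ⬝ᵥ p) : ℤ) = 0 := by
  have hgen : ∀ q : Fin n → ℝ, q ∉ Submodule.span ℝ (Δ.cone J : Set (Fin n → ℝ)) →
      Δ.IsGenericVec J (Submodule.Quotient.mk q) := by
    intro q hq J' hJ' hJJ' hcard
    have : J = J' := Finset.eq_of_subset_of_card_le hJJ' (by omega)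
    subst this
    intro hmem
    have hz : Submodule.span ℝ (Δ.projCone J J : Set (Δ.QuotSpace J)) ≤ ⊥ := by
      rw [Submodule.span_le]
      rintro _ ⟨c, hc, rfl⟩
      simp only [SetLike.mem_coe, Submodule.mem_bot]
      exact (Submodule.Quotient.mk_eq_zero _).2 (Submodule.subset_span hc)
    exact hq ((Submodule.Quotient.mk_eq_zero _).1 (by simpa using hz hmem))
  have hnp : -p ∉ Submodule.span ℝ (Δ.cone J : Set (Fin n → ℝ)) := by rwa [neg_mem_iff]
  -- Each facet around J contains exactly one of p and −p in its projected half-line, so the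
  -- difference of the two degrees is the signed sum.
  have h := hpre _ _ (hgen p hp) (hgen (-p) hnp)
  unfold degAt at h
  rw [Finset.sum_filter, Finset.sum_filter, ← sub_eq_zero, ← Finset.sum_sub_distrib] at h
  rw [← h]
  refine Finset.sum_congr rfl fun I hI => ?_
  obtain ⟨hIf, hJI⟩ := mem_facetsAt.1 hI
  obtain ⟨i, hi⟩ : ∃ i, I \ J = {i} := by
    rw [← Finset.card_eq_one, Finset.card_sdiff_of_subset hJI, (mem_facets.1 hIf).2]; omega
  have hiI : i ∈ I \ J := by simp [hi]
  have hiJ := (Finset.mem_sdiff.1 hiI).2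
  have hins : insert i J = I := by
    rw [Finset.insert_eq, ← hi, Finset.sdiff_union_of_subset hJI]
  have hne : V.dualVec I i ⬝ᵥ p ≠ 0 := by
    intro h0
    apply hp
    have := V.sum_dualVec_smul hIf p
    rw [← hins, Finset.sum_insert hiJ, hins, h0, zero_smul, zero_add] at this
    rw [← this, V.span_cone hJ]
    exact sum_mem fun j hj => Submodule.smul_mem _ _ (Submodule.subset_span ⟨j, hj, rfl⟩)
  rw [hi, Finset.sum_singleton, V.mem_projCone_iff hIf hiJ hins, V.mem_projCone_iff hIf hiJ hins,
    dotProduct_neg]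
  rcases hne.lt_or_gt with h0 | h0
  · rw [if_neg (by linarith), if_pos (by linarith), sign_neg h0]; simp
  · rw [if_pos (by linarith), if_neg (by linarith), sign_pos h0]; simp

end EdgeVectors
end MultiFan

/-! ### Exponentials and Todd series in `HPt`. -/

open PowerSeries in
/-- The functional equation of the exponential power series, in substituted form. -/
theorem PowerSeries.subst_add_exp {τ : Type*} [Finite τ] {a b : MvPowerSeries τ ℂ}
    (ha : a.constantCoeff = 0) (hb : b.constantCoeff = 0) :
    subst (a + b) (exp ℂ) = subst a (exp ℂ) * subst b (exp ℂ) := by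
  -- The universal case in two variables; on coefficients it says that binom(a+b, a)/(a+b)! = 1/(a!
  -- b!).
  have h2 : subst (MvPowerSeries.X 0 + MvPowerSeries.X 1 : MvPowerSeries (Fin 2) ℂ) (exp ℂ) =
      subst (MvPowerSeries.X 0 : MvPowerSeries (Fin 2) ℂ) (exp ℂ) *
        subst (MvPowerSeries.X 1 : MvPowerSeries (Fin 2) ℂ) (exp ℂ) := by
    ext e
    rw [coeff_subst_X_zero_add_X_one, coeff_subst_X_zero_subst_mul_X_one]
    simp only [coeff_exp]
    rw [Nat.choose_symm_add, Nat.add_choose]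
    have h1 := Nat.factorial_ne_zero (e 0)
    have h3 := Nat.factorial_ne_zero (e 1)
    have h4 := Nat.factorial_ne_zero (e 0 + e 1)
    rw [Nat.cast_div (Nat.factorial_mul_factorial_dvd_factorial_add _ _)
      (by exact_mod_cast mul_ne_zero h1 h3)]
    simp only [map_div₀, map_one, map_natCast, Nat.cast_mul]
    field_simp
  have hs : MvPowerSeries.HasSubst ![a, b] := by
    apply MvPowerSeries.hasSubst_of_constantCoeff_zero
    intro i; fin_cases i <;> simp [ha, hb]
  have hX : ∀ i : Fin 2, PowerSeries.HasSubst (MvPowerSeries.X i : MvPowerSeries (Fin 2) ℂ) :=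
    fun i => HasSubst.X i
  have hadd : PowerSeries.HasSubst
      (MvPowerSeries.X 0 + MvPowerSeries.X 1 : MvPowerSeries (Fin 2) ℂ) := (hX 0).add (hX 1)
  have h3 := congrArg (MvPowerSeries.subst ![a, b]) h2
  rw [MvPowerSeries.subst_mul hs] at h3
  unfold PowerSeries.subst at h3 ⊢
  rw [MvPowerSeries.subst_comp_subst_apply hadd.const hs,
    MvPowerSeries.subst_comp_subst_apply (hX 0).const hs,
    MvPowerSeries.subst_comp_subst_apply (hX 1).const hs] at h3
  simpa [MvPowerSeries.subst_add hs, MvPowerSeries.subst_X hs] using h3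

/-- The exponential `e^u` of `u ∈ M_ℝ`. -/
def expR {n : ℕ} (u : Fin n → ℝ) : HPt n := PowerSeries.subst (linForm u) (PowerSeries.exp ℂ)

theorem expM_eq_expR {n : ℕ} (u : Fin n → ℤ) : expM u = expR (latVec u) := rfl

theorem constantCoeff_linForm {n : ℕ} (u : Fin n → ℝ) :
    MvPowerSeries.constantCoeff (linForm u) = 0 := by
  simp [linForm]

theorem linForm_add {n : ℕ} (u v : Fin n → ℝ) : linForm (u + v) = linForm u + linForm v := by
  simp [linForm, add_mul, Finset.sum_add_distrib]

theorem linForm_smul {n : ℕ} (c : ℝ) (u : Fin n → ℝ) :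
    linForm (c • u) = MvPowerSeries.C (c : ℂ) * linForm u := by
  simp [linForm, Finset.mul_sum, mul_assoc]

theorem linForm_zero {n : ℕ} : linForm (0 : Fin n → ℝ) = 0 := by
  simp [linForm]

theorem linForm_sum {n : ℕ} {κ : Type*} (s : Finset κ) (f : κ → Fin n → ℝ) :
    linForm (∑ i ∈ s, f i) = ∑ i ∈ s, linForm (f i) := by
  classical
  induction s using Finset.induction_on with
  | empty => simp [linForm_zero]
  | insert a s ha ih => rw [Finset.sum_insert ha, Finset.sum_insert ha, linForm_add, ih]

theorem linForm_neg {n : ℕ} (u : Fin n → ℝ) : linForm (-u) = -linForm u := by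
  simp [linForm]

theorem linForm_ne_zero {n : ℕ} {u : Fin n → ℝ} (hu : u ≠ 0) : linForm u ≠ 0 := by
  intro h
  apply hu
  ext j
  have := congrArg (MvPowerSeries.coeff (Finsupp.single j 1)) h
  simp only [linForm, map_sum, MvPowerSeries.coeff_C_mul, MvPowerSeries.coeff_X, map_zero] at this
  simpa [Finsupp.single_left_inj] using this

theorem hasSubst_linForm {n : ℕ} (u : Fin n → ℝ) : PowerSeries.HasSubst (linForm u) :=
  PowerSeries.HasSubst.of_constantCoeff_zero (constantCoeff_linForm u)

theorem expR_add {n : ℕ} (u v : Fin n → ℝ) : expR (u + v) = expR u * expR v := by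
  rw [expR, linForm_add]
  exact PowerSeries.subst_add_exp (constantCoeff_linForm u) (constantCoeff_linForm v)

theorem constantCoeff_expR {n : ℕ} (u : Fin n → ℝ) :
    MvPowerSeries.constantCoeff (expR u) = 1 := by
  rw [expR, PowerSeries.constantCoeff_subst (hasSubst_linForm u), finsum_eq_single _ 0]
  · simp
  · intro k hk
    simp [map_pow, constantCoeff_linForm, hk]

@[simp] theorem expR_zero {n : ℕ} : expR (0 : Fin n → ℝ) = 1 := by
  have h := expR_add (0 : Fin n → ℝ) 0
  rw [add_zero] at h
  have h0 : expR (0 : Fin n → ℝ) ≠ 0 := by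
    intro h0
    have := constantCoeff_expR (0 : Fin n → ℝ)
    simp [h0] at this
  exact (mul_left_cancel₀ h0 (by rw [← h, mul_one])).symm

theorem expR_sum {n : ℕ} {κ : Type*} (s : Finset κ) (f : κ → Fin n → ℝ) :
    expR (∑ i ∈ s, f i) = ∏ i ∈ s, expR (f i) := by
  classical
  induction s using Finset.induction_on with
  | empty => simp
  | insert a s ha ih => rw [Finset.sum_insert ha, Finset.prod_insert ha, expR_add, ih]

theorem expR_nsmul {n : ℕ} (k : ℕ) (u : Fin n → ℝ) : expR ((k : ℝ) • u) = expR u ^ k := by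
  induction k with
  | zero => simp
  | succ k ih => rw [Nat.cast_succ, add_smul, one_smul, expR_add, ih, pow_succ]

/-- The defining property of `u / (1 - χ e^{-u})`. -/
theorem subst_toddSeries_mul {n : ℕ} (χ : ℂ) (u : Fin n → ℝ) :
    PowerSeries.subst (linForm u) (toddSeries χ) * (1 - MvPowerSeries.C χ * expR (-u)) =
      linForm u := by
  have h := congrArg (PowerSeries.subst (linForm u)) (toddSeries_mul χ)
  have hu := hasSubst_linForm u
  rw [PowerSeries.subst_mul hu, PowerSeries.subst_X hu, PowerSeries.subst_sub hu,
    PowerSeries.subst_mul hu, PowerSeries.subst_C, PowerSeries.evalNegHom,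
    PowerSeries.rescale_eq_subst, PowerSeries.subst_comp_subst_apply
      (PowerSeries.HasSubst.smul_X' (-1 : ℂ)) hu, PowerSeries.subst_smul hu,
    PowerSeries.subst_X hu] at h
  rw [← map_one (PowerSeries.C (R := ℂ)), PowerSeries.subst_C, map_one] at h
  rw [neg_one_smul, ← linForm_neg] at h
  exact h

/-- Clearing the denominator of `u / (1 - χ e^{-u})` when `χ` is an `N`-th root of unity. -/
theorem subst_toddSeries_mul_one_sub {n : ℕ} {χ : ℂ} {N : ℕ} (hχ : χ ^ N = 1) (u : Fin n → ℝ) :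
    PowerSeries.subst (linForm u) (toddSeries χ) * (1 - expR (-((N : ℝ) • u))) =
      linForm u * ∑ k ∈ Finset.range N, MvPowerSeries.C (χ ^ k) * expR (-((k : ℝ) • u)) := by
  have h := mul_neg_geom_sum (MvPowerSeries.C χ * expR (-u)) N
  rw [mul_pow, ← map_pow, hχ, map_one, one_mul] at h
  have e : ∀ k : ℕ, expR (-((k : ℝ) • u)) = expR (-u) ^ k := by
    intro k; rw [← smul_neg, expR_nsmul]
  simp only [e]
  rw [← h, ← mul_assoc, subst_toddSeries_mul]
  congr 1
  refine Finset.sum_congr rfl fun k _ => ?_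
  rw [mul_pow, map_pow]

theorem constantCoeff_toddSeries_of_ne_one {χ : ℂ} (h : χ ≠ 1) :
    PowerSeries.constantCoeff (toddSeries χ) = 0 := by
  simp [toddSeries, h]

theorem constantCoeff_toddSeries_one : PowerSeries.constantCoeff (toddSeries 1) = 1 := by
  rw [toddSeries, if_pos rfl, PowerSeries.constantCoeff_inv,
    ← PowerSeries.coeff_zero_eq_constantCoeff_apply]
  simp [PowerSeries.evalNegHom, PowerSeries.coeff_rescale, PowerSeries.coeff_one]

/-- This factor divides a non-zero linear form, by the defining equation of the Todd series at χ =
1. -/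
theorem one_sub_expR_ne_zero {n : ℕ} {u : Fin n → ℝ} (hu : u ≠ 0) : 1 - expR u ≠ 0 := by
  intro h
  have := subst_toddSeries_mul 1 (-u)
  rw [map_one, one_mul, neg_neg, h, mul_zero] at this
  exact linForm_ne_zero (neg_ne_zero.2 hu) this.symm

/-! ### Ray crossings and generic directions. -/

open Classical in
/-- Let `a`, `b` be the coordinates of `v`, `p` in a basis of a simplicial cone. The ray `v - t p`,
`t ≥ 0`, starts in the cone if and only if it leaves the cone once more often than it enters. -/
theorem ray_crossing_identity {κ : Type*} (S : Finset κ) (a b : κ → ℝ)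
    [Decidable (∀ i ∈ S, 0 < a i)]
    (ha : ∀ i ∈ S, a i ≠ 0) (hb : ∀ i ∈ S, b i ≠ 0)
    (hab : ∀ i ∈ S, ∀ j ∈ S, i ≠ j → a i * b j - a j * b i ≠ 0) (hpos : ∃ i ∈ S, 0 < b i) :
    (if ∀ i ∈ S, 0 < a i then (1 : ℤ) else 0) =
      ∑ i ∈ S, (SignType.sign (b i) : ℤ) *
        if 0 < a i / b i ∧ ∀ j ∈ S, j ≠ i → 0 < a j - a i / b i * b j then 1 else 0 := by
  -- The i-th coordinate vanishes at time t i. It is positive before this time if 0 < b i and after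
  -- it if b i < 0, so the open cone cuts the line in the interval from the last entry time (over Q)
  -- to the first exit time (over P).
  set t : κ → ℝ := fun i => a i / b i with ht
  have hat : ∀ i ∈ S, a i = t i * b i := fun i hi => by rw [ht]; field_simp [hb i hi]
  have hinj : ∀ i ∈ S, ∀ j ∈ S, i ≠ j → t i ≠ t j := by
    intro i hi j hj hij h
    apply hab i hi j hj hij
    rw [hat i hi, hat j hj, h]; ring
  have ht0 : ∀ i ∈ S, t i ≠ 0 := fun i hi => div_ne_zero (ha i hi) (hb i hi)
  have hcmp : ∀ j ∈ S, ∀ s : ℝ, 0 < a j - s * b j ↔ (0 < b j ∧ s < t j) ∨ (b j < 0 ∧ t j < s) := by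
    intro j hj s
    rw [hat j hj, ← sub_mul]
    rcases (hb j hj).lt_or_gt with h | h
    · constructor
      · intro h1; right; exact ⟨h, by nlinarith⟩
      · rintro (h1 | h1)
        · linarith [h1.1]
        · nlinarith [h1.2]
    · rw [mul_pos_iff_of_pos_right h]
      constructor
      · intro h1; left; exact ⟨h, by linarith⟩
      · rintro (h1 | h1)
        · linarith [h1.2]
        · linarith [h1.1]
  have hzero : ∀ j ∈ S, 0 < a j ↔ (0 < b j ∧ 0 < t j) ∨ (b j < 0 ∧ t j < 0) := by
    intro j hj; simpa using hcmp j hj 0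
  set P := S.filter fun i => 0 < b i with hP
  set Q := S.filter fun i => ¬ 0 < b i with hQ
  have hQneg : ∀ q ∈ Q, q ∈ S ∧ b q < 0 := by
    intro q hq
    rw [hQ, Finset.mem_filter] at hq
    exact ⟨hq.1, lt_of_le_of_ne (not_lt.1 hq.2) (hb q hq.1)⟩
  have hPpos : ∀ q ∈ P, q ∈ S ∧ 0 < b q := fun q hq => Finset.mem_filter.1 hq
  obtain ⟨u, huP, hu⟩ := Finset.exists_min_image P t
    (by obtain ⟨i, hi, h⟩ := hpos; exact ⟨i, Finset.mem_filter.2 ⟨hi, h⟩⟩)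
  obtain ⟨huS, hub⟩ := hPpos u huP
  have hmono : ∀ s : ℝ, s < t u → ∀ j ∈ P, s < t j := fun s hs j hj => hs.trans_le (hu j hj)
  rw [← Finset.sum_filter_add_sum_filter_not S (fun i => 0 < b i), ← hP, ← hQ]
  -- Among the exits only the earliest can be a boundary crossing: at a later one the coordinate u
  -- is already negative.
  have hsumP : (∑ i ∈ P, (SignType.sign (b i) : ℤ) *
      if 0 < t i ∧ ∀ j ∈ S, j ≠ i → 0 < a j - t i * b j then 1 else 0) =
      if 0 < t u ∧ ∀ q ∈ Q, t q < t u then 1 else 0 := by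
    rw [Finset.sum_eq_single u]
    · rw [sign_pos hub]
      simp only [SignType.coe_one, one_mul]
      refine if_congr (and_congr_right fun _ => ?_) rfl rfl
      constructor
      · intro h q hq
        obtain ⟨hqS, hqb⟩ := hQneg q hq
        have hne : q ≠ u := by rintro rfl; linarith
        rcases (hcmp q hqS _).1 (h q hqS hne) with h1 | h1
        · linarith [h1.1]
        · exact h1.2
      · intro h j hj hne
        rw [hcmp j hj]
        rcases (hb j hj).lt_or_gt with h1 | h1
        · right; exact ⟨h1, h j (Finset.mem_filter.2 ⟨hj, by linarith⟩)⟩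
        · left
          exact ⟨h1, lt_of_le_of_ne (hu j (Finset.mem_filter.2 ⟨hj, h1⟩)) (hinj u huS j hj hne.symm)⟩
    · intro i hi hne
      rw [if_neg, mul_zero]
      rintro ⟨-, h⟩
      rcases (hcmp u huS _).1 (h u huS hne.symm) with h1 | h1
      · linarith [hu i hi, h1.2]
      · linarith [h1.1]
    · intro h; exact absurd huP h
  rw [hsumP]
  have hL : (∀ i ∈ S, 0 < a i) ↔ 0 < t u ∧ ∀ q ∈ Q, t q < 0 := by
    constructor
    · intro h
      refine ⟨?_, fun q hq => ?_⟩
      · rcases (hzero u huS).1 (h u huS) with h1 | h1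
        · exact h1.2
        · linarith [h1.1]
      · obtain ⟨hqS, hqb⟩ := hQneg q hq
        rcases (hzero q hqS).1 (h q hqS) with h1 | h1
        · linarith [h1.1]
        · exact h1.2
    · rintro ⟨h, h'⟩ i hi
      rw [hzero i hi]
      rcases (hb i hi).lt_or_gt with h1 | h1
      · right; exact ⟨h1, h' i (Finset.mem_filter.2 ⟨hi, by linarith⟩)⟩
      · left; exact ⟨h1, hmono 0 h i (Finset.mem_filter.2 ⟨hi, h1⟩)⟩
  rw [if_congr hL rfl rfl]
  rcases Q.eq_empty_or_nonempty with hQe | hQn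
  · simp [hQe]
  obtain ⟨l, hlQ, hl⟩ := Finset.exists_max_image Q t hQn
  obtain ⟨hlS, hlb⟩ := hQneg l hlQ
  have hlu : l ≠ u := by rintro rfl; linarith
  -- Symmetrically, only the latest entry can count, and it does so exactly when it precedes the
  -- first exit.
  have hsumQ : (∑ i ∈ Q, (SignType.sign (b i) : ℤ) *
      if 0 < t i ∧ ∀ j ∈ S, j ≠ i → 0 < a j - t i * b j then 1 else 0) =
      if 0 < t l ∧ t l < t u then -1 else 0 := by
    rw [Finset.sum_eq_single l]
    · rw [sign_neg hlb, mul_ite, mul_zero]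
      refine if_congr (and_congr_right fun _ => ?_) (by simp) rfl
      constructor
      · intro h
        rcases (hcmp u huS _).1 (h u huS hlu.symm) with h1 | h1
        · exact h1.2
        · linarith [h1.1]
      · intro h j hj hne
        rw [hcmp j hj]
        rcases (hb j hj).lt_or_gt with h1 | h1
        · right
          exact ⟨h1, lt_of_le_of_ne (hl j (Finset.mem_filter.2 ⟨hj, by linarith⟩))
            (hinj j hj l hlS hne)⟩
        · left
          exact ⟨h1, hmono _ h j (Finset.mem_filter.2 ⟨hj, h1⟩)⟩
    · intro i hi hne
      rw [if_neg, mul_zero]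
      rintro ⟨-, h⟩
      rcases (hcmp l hlS _).1 (h l hlS hne.symm) with h1 | h1
      · linarith [h1.1]
      · linarith [hl i hi, h1.2]
    · intro h; exact absurd hlQ h
  rw [hsumQ]
  have e : ∀ s : ℝ, (∀ q ∈ Q, t q < s) ↔ t l < s :=
    fun s => ⟨fun h => h l hlQ, fun h q hq => (hl q hq).trans_lt h⟩
  rw [if_congr (and_congr_right fun _ => e 0) rfl rfl,
    if_congr (and_congr_right fun _ => e (t u)) rfl rfl]
  rcases (ht0 l hlS).lt_or_gt with h1 | h1
  · by_cases h2 : 0 < t u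
    · simp [h1, h2, h1.trans h2, h1.not_gt]
    · simp [h2, h1.not_gt]
  · by_cases h2 : t l < t u
    · simp [h1, h2, h1.trans h2, h1.not_gt]
    · simp [h1.not_gt, h2]

theorem mul_pos_iff_neg_of_neg {a b : ℝ} (hb : b < 0) : 0 < a * b ↔ a < 0 :=
  ⟨fun h => by nlinarith, fun h => mul_pos_of_neg_of_neg h hb⟩

open Filter Topology in
/-- A point of an open cone can be moved off finitely many linear hyperplanes. -/
theorem exists_generic_perturbation {n : ℕ} {κ μ : Type*} [Finite κ] [Finite μ]
    (f : κ → Fin n → ℝ) (g : μ → Fin n → ℝ) (y : Fin n → ℝ) :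
    ∃ p : Fin n → ℝ, (∀ k, f k ≠ 0 → f k ⬝ᵥ p ≠ 0) ∧ ∀ m, 0 < g m ⬝ᵥ y → 0 < g m ⬝ᵥ p := by
  -- The vector q avoids all the hyperplanes at once, and p will be y + δ q for a small δ > 0: q
  -- handles the hyperplanes through y, continuity all other conditions.
  obtain ⟨q, hq⟩ := Module.Dual.exists_forall_ne_zero_of_forall_exists (K := ℝ)
    (fun k : {k // f k ≠ 0} => dotProductBilin ℝ ℝ (f k.1)) (fun k => by
      refine ⟨f k.1, fun h => k.2 ?_⟩
      exact dotProduct_self_eq_zero.1 h)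
  have hcont : ∀ x : Fin n → ℝ, Tendsto (fun δ : ℝ => x ⬝ᵥ (y + δ • q)) (𝓝[>] 0) (𝓝 (x ⬝ᵥ y)) := by
    intro x
    have : Continuous fun δ : ℝ => x ⬝ᵥ (y + δ • q) := by
      simp only [dotProduct_add, dotProduct_smul]
      fun_prop
    have h := (this.tendsto 0).mono_left (nhdsWithin_le_nhds (s := Set.Ioi 0))
    simpa using h
  have h1 : ∀ᶠ δ in 𝓝[>] (0 : ℝ), ∀ k, f k ≠ 0 → f k ⬝ᵥ (y + δ • q) ≠ 0 := by
    rw [eventually_all]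
    intro k
    by_cases hy : f k ⬝ᵥ y = 0
    · filter_upwards [self_mem_nhdsWithin] with δ hδ hk
      rw [dotProduct_add, hy, zero_add, dotProduct_smul]
      exact mul_ne_zero (ne_of_gt hδ) (hq ⟨k, hk⟩)
    · filter_upwards [(hcont (f k)).eventually_ne hy] with δ hδ _
      exact hδ
  have h2 : ∀ᶠ δ in 𝓝[>] (0 : ℝ), ∀ m, 0 < g m ⬝ᵥ y → 0 < g m ⬝ᵥ (y + δ • q) := by
    rw [eventually_all]
    intro m
    by_cases hy : 0 < g m ⬝ᵥ y
    · filter_upwards [(hcont (g m)).eventually (lt_mem_nhds hy)] with δ hδ _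
      exact hδ
    · exact Eventually.of_forall fun δ h => absurd h hy
  obtain ⟨δ, h⟩ := (h1.and h2).exists
  exact ⟨_, h⟩

/-! ### Vanishing and finite support of the Duistermaat–Heckman function. -/

namespace MultiFan.EdgeVectors

variable {ι : Type*} [Fintype ι] [DecidableEq ι] {n : ℕ} {Δ : MultiFan ι n} (V : Δ.EdgeVectors)

/-- The coordinates of u in the dual basis are its pairings with the v_i, so the cone is cut out by
one condition per vertex of I. -/
theorem mem_dualConePos_iff {K I : Finset ι} (hI : I ∈ Δ.facets) (hK : K ⊆ I) (d : ι → ℝ)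
    (v u : Fin n → ℝ) :
    u ∈ V.dualConePos K d v I ↔ (∀ i ∈ K, u ⬝ᵥ latVec (V.vec i) = d i) ∧
      ∀ i ∈ I \ K, (0 < V.dualVec I i ⬝ᵥ v → d i ≤ u ⬝ᵥ latVec (V.vec i)) ∧
        (¬ 0 < V.dualVec I i ⬝ᵥ v → u ⬝ᵥ latVec (V.vec i) ≤ d i) := by
  classical
  set s : ι → ℝ := fun i => if 0 < V.dualVec I i ⬝ᵥ v then 1 else -1 with hs
  have hpos : ∀ i, V.dualVecPos v I i = s i • V.dualVec I i := by
    intro i; by_cases h : 0 < V.dualVec I i ⬝ᵥ v <;> simp [hs, dualVecPos, h]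
  constructor
  · rintro ⟨c, hc, rfl⟩
    have key : ∀ j ∈ I, (V.vertexPt d I + ∑ i ∈ I \ K, c i • V.dualVecPos v I i) ⬝ᵥ
        latVec (V.vec j) = d j + if j ∈ K then 0 else c j * s j := by
      intro j hj
      rw [add_dotProduct, V.vertexPt_dotProduct hI d hj]
      congr 1
      have : ∑ i ∈ I \ K, c i • V.dualVecPos v I i =
          ∑ i ∈ I, (if i ∈ K then 0 else c i * s i) • V.dualVec I i := by
        rw [← Finset.sum_sdiff hK, Finset.sum_eq_zero (s := K), add_zero]
        · refine Finset.sum_congr rfl fun i hi => ?_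
          rw [if_neg (Finset.mem_sdiff.1 hi).2, hpos, smul_smul]
        · intro i hi; simp [hi]
      rw [this, V.sum_smul_dualVec_dotProduct hI (fun i => if i ∈ K then 0 else c i * s i) hj]
    refine ⟨fun i hi => by simp [key i (hK hi), hi], fun i hi => ?_⟩
    obtain ⟨hiI, hiK⟩ := Finset.mem_sdiff.1 hi
    rw [key i hiI, if_neg hiK]
    refine ⟨fun h => ?_, fun h => ?_⟩
    · simp [hs, h, hc i]
    · simp [hs, h, hc i]
  · rintro ⟨h1, h2⟩
    refine ⟨fun i => |u ⬝ᵥ latVec (V.vec i) - d i|, fun i => abs_nonneg _, ?_⟩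
    have e : ∑ i ∈ I \ K, |u ⬝ᵥ latVec (V.vec i) - d i| • V.dualVecPos v I i =
        ∑ i ∈ I, (u ⬝ᵥ latVec (V.vec i) - d i) • V.dualVec I i := by
      rw [← Finset.sum_sdiff hK, Finset.sum_eq_zero (s := K), add_zero]
      · refine Finset.sum_congr rfl fun i hi => ?_
        rw [hpos, smul_smul, hs]
        obtain ⟨ha, hb⟩ := h2 i hi
        by_cases h : 0 < V.dualVec I i ⬝ᵥ v
        · simp only [h, if_true, mul_one]
          rw [abs_of_nonneg (by linarith [ha h])]
        · simp only [h, if_false]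
          rw [abs_of_nonpos (by linarith [hb h])]; simp
      · intro i hi; simp [h1 i hi]
    rw [e]
    simp only [sub_smul, Finset.sum_sub_distrib, V.sum_smul_dualVec hI]
    simp [vertexPt]

/-- Double counting of pairs (facet, wall of it): crossings collected facet by facet are regrouped
wall by wall, where completeness applies. -/
theorem sum_facetsAt_erase {K : Finset ι} (X : Finset ι → ℤ) (Y : Finset ι → ι → ℤ) :
    ∑ I ∈ Δ.facetsAt K, ∑ i ∈ I \ K, X (I.erase i) * Y I i =
      ∑ J ∈ Δ.faces.filter (fun J => K ⊆ J ∧ J.card + 1 = n),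
        X J * ∑ I ∈ Δ.facetsAt J, ∑ i ∈ I \ J, Y I i := by
  simp only [Finset.mul_sum]
  simp only [Finset.sum_sigma']
  refine Finset.sum_bij' (fun x _ => ⟨x.1.erase x.2, x.1, x.2⟩) (fun x _ => ⟨x.2.1, x.2.2⟩)
    ?_ ?_ ?_ ?_ ?_
  · rintro ⟨I, i⟩ h
    simp only [Finset.mem_sigma, Finset.mem_sdiff, mem_facetsAt, mem_facets, Finset.mem_filter] at h ⊢
    obtain ⟨⟨⟨hI, hc⟩, hK⟩, hi, hiK⟩ := h
    refine ⟨⟨Δ.down_closed I hI _ (Finset.erase_subset i I), ?_, ?_⟩,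
      ⟨⟨hI, hc⟩, Finset.erase_subset i I⟩, hi, by simp⟩
    · exact fun k hk => Finset.mem_erase.2 ⟨fun h => hiK (h ▸ hk), hK hk⟩
    · rw [Finset.card_erase_add_one hi, hc]
  · rintro ⟨J, I, i⟩ h
    simp only [Finset.mem_sigma, Finset.mem_sdiff, mem_facetsAt, mem_facets, Finset.mem_filter] at h ⊢
    obtain ⟨⟨hJ, hKJ, hJc⟩, ⟨⟨hI, hc⟩, hJI⟩, hi, hiJ⟩ := h
    exact ⟨⟨⟨hI, hc⟩, hKJ.trans hJI⟩, hi, fun h => hiJ (hKJ h)⟩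
  · rintro ⟨I, i⟩ h; rfl
  · rintro ⟨J, I, i⟩ h
    simp only [Finset.mem_sigma, Finset.mem_sdiff, mem_facetsAt, mem_facets, Finset.mem_filter] at h
    obtain ⟨⟨hJ, hKJ, hJc⟩, ⟨⟨hI, hc⟩, hJI⟩, hi, hiJ⟩ := h
    have : I.erase i = J := by
      symm
      apply Finset.eq_of_subset_of_card_le
      · exact fun k hk => Finset.mem_erase.2 ⟨fun h => hiJ (h ▸ hk), hJI hk⟩
      · have := Finset.card_erase_add_one hi; omega
    simp [this]
  · rintro ⟨I, i⟩ h; rfl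

open Classical in
/-- The Duistermaat–Heckman function vanishes at the points `u` off the walls that can be separated
from all the vertices by a single linear functional. -/
theorem DH_eq_zero (hΔ : Δ.IsComplete) {K : Finset ι} {v : Fin n → ℝ}
    (hv : V.IsGeneric K v) {d : ι → ℝ} {u : Fin n → ℝ}
    (hne : ∀ i, i ∉ K → u ⬝ᵥ latVec (V.vec i) ≠ d i)
    (hA : ∀ i ∈ K, u ⬝ᵥ latVec (V.vec i) = d i) {y : Fin n → ℝ}
    (hy : ∀ I ∈ Δ.facetsAt K, 0 < (u - V.vertexPt d I) ⬝ᵥ y) : V.DH K d v u = 0 := by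
  -- The diagonal conditions make every ⟨u_i^I, p⟩ non-zero. The others make the ray v − t p cross
  -- distinct walls of a facet at distinct times.
  obtain ⟨p, hp1, hp2⟩ := exists_generic_perturbation
    (fun k : Finset ι × ι × ι => if k.2.1 = k.2.2 then V.dualVec k.1 k.2.1 else
      (V.dualVec k.1 k.2.1 ⬝ᵥ v) • V.dualVec k.1 k.2.2 -
        (V.dualVec k.1 k.2.2 ⬝ᵥ v) • V.dualVec k.1 k.2.1)
    (fun I : Finset ι => u - V.vertexPt d I) y
  set m : ι → ℝ := fun i => u ⬝ᵥ latVec (V.vec i) - d i with hm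
  have hm0 : ∀ i, i ∉ K → m i ≠ 0 := fun i hi => sub_ne_zero.2 (hne i hi)
  have hb : ∀ I ∈ Δ.facetsAt K, ∀ i ∈ I, V.dualVec I i ⬝ᵥ p ≠ 0 := by
    intro I hI i hi
    have := hp1 (I, i, i)
    simp only [if_true] at this
    exact this (V.dualVec_ne_zero (mem_facetsAt.1 hI).1 hi)
  have hab : ∀ I ∈ Δ.facetsAt K, ∀ i ∈ I \ K, ∀ j ∈ I \ K, i ≠ j →
      (V.dualVec I i ⬝ᵥ v) * (V.dualVec I j ⬝ᵥ p) -
        (V.dualVec I j ⬝ᵥ v) * (V.dualVec I i ⬝ᵥ p) ≠ 0 := by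
    intro I hI i hi j hj hij
    have hIf := (mem_facetsAt.1 hI).1
    have hiI := (Finset.mem_sdiff.1 hi).1
    have hjI := (Finset.mem_sdiff.1 hj).1
    have := hp1 (I, i, j)
    simp only [hij, if_false] at this
    rw [sub_dotProduct, smul_dotProduct, smul_dotProduct, smul_eq_mul, smul_eq_mul] at this
    refine this fun h0 => ?_
    have h1 := congrArg (fun x => x ⬝ᵥ latVec (V.vec j)) h0
    simp only [sub_dotProduct, smul_dotProduct, V.dualVec_dotProduct hIf hjI hjI,
      V.dualVec_dotProduct hIf hiI hjI, if_true, if_neg hij.symm, zero_dotProduct] at h1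
    apply hv I hI i hi
    simpa using h1
  -- The ray meets the reflected wall, in which the coefficient at j ∈ J \ K has the sign of m_j. No
  -- facet is mentioned: this makes the regrouping by walls possible.
  set Pr : Finset ι → Prop := fun J => ∃ t : ℝ, 0 < t ∧ ∃ c : ι → ℝ,
    v - t • p = ∑ j ∈ J, c j • latVec (V.vec j) ∧ ∀ j ∈ J \ K, 0 < m j * c j with hPr
  have hPr_iff : ∀ I ∈ Δ.facetsAt K, ∀ i ∈ I \ K,
      ((0 < (m i * (V.dualVec I i ⬝ᵥ v)) / (m i * (V.dualVec I i ⬝ᵥ p)) ∧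
        ∀ j ∈ I \ K, j ≠ i → 0 < m j * (V.dualVec I j ⬝ᵥ v) -
          (m i * (V.dualVec I i ⬝ᵥ v)) / (m i * (V.dualVec I i ⬝ᵥ p)) *
            (m j * (V.dualVec I j ⬝ᵥ p))) ↔ Pr (I.erase i)) := by
    intro I hI i hi
    have hIf := (mem_facetsAt.1 hI).1
    obtain ⟨hiI, hiK⟩ := Finset.mem_sdiff.1 hi
    rw [mul_div_mul_left _ _ (hm0 i hiK)]
    set t := (V.dualVec I i ⬝ᵥ v) / (V.dualVec I i ⬝ᵥ p) with ht
    have htp : V.dualVec I i ⬝ᵥ v = t * (V.dualVec I i ⬝ᵥ p) := by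
      rw [ht, div_mul_cancel₀ _ (hb I hI i hiI)]
    constructor
    · rintro ⟨h1, h2⟩
      refine ⟨t, h1, fun j => V.dualVec I j ⬝ᵥ (v - t • p), ?_, fun j hj => ?_⟩
      · have h3 := V.sum_dualVec_smul hIf (v - t • p)
        rw [← Finset.add_sum_erase _ _ hiI, dotProduct_sub, htp, dotProduct_smul, smul_eq_mul,
          sub_self, zero_smul, zero_add] at h3
        exact h3.symm
      · obtain ⟨hj, hjK⟩ := Finset.mem_sdiff.1 hj
        obtain ⟨hji, hjI⟩ := Finset.mem_erase.1 hj
        have := h2 j (Finset.mem_sdiff.2 ⟨hjI, hjK⟩) hji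
        change 0 < m j * (V.dualVec I j ⬝ᵥ (v - t • p))
        rw [dotProduct_sub, dotProduct_smul, smul_eq_mul]
        linarith
    · rintro ⟨t', h1, c, h2, h3⟩
      have h4 : ∀ j ∈ I, V.dualVec I j ⬝ᵥ v - t' * (V.dualVec I j ⬝ᵥ p) =
          if j ∈ I.erase i then c j else 0 := by
        intro j hj
        have := congrArg (fun x => V.dualVec I j ⬝ᵥ x) h2
        simp only [V.dualVec_dotProduct_sum_smul hIf c hj (Finset.erase_subset i I)] at this
        rw [← this, dotProduct_sub, dotProduct_smul, smul_eq_mul]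
      have h5 : t' = t := by
        have := h4 i hiI
        rw [if_neg (by simp), htp, ← sub_mul] at this
        rcases mul_eq_zero.1 this with h | h
        · linarith
        · exact absurd h (hb I hI i hiI)
      subst h5
      refine ⟨h1, fun j hj hji => ?_⟩
      obtain ⟨hjI, hjK⟩ := Finset.mem_sdiff.1 hj
      have hje := Finset.mem_erase.2 ⟨hji, hjI⟩
      have := h4 j hjI
      rw [if_pos hje] at this
      have h6 := h3 j (Finset.mem_sdiff.2 ⟨hje, hjK⟩)
      rw [← this] at h6
      linarith
  have hterm : ∀ I ∈ Δ.facetsAt K,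
      (if u ∈ V.dualConePos K d v I then V.signAt K v I * Δ.w I else 0) =
      ∑ i ∈ I \ K, (-(∏ j ∈ I.erase i \ K, -(SignType.sign (m j) : ℤ)) *
        if Pr (I.erase i) then 1 else 0) * (Δ.w I * (SignType.sign (V.dualVec I i ⬝ᵥ p) : ℤ)) := by
    intro I hI
    obtain ⟨hIf, hKI⟩ := mem_facetsAt.1 hI
    have hmem : u ∈ V.dualConePos K d v I ↔ ∀ i ∈ I \ K, 0 < m i * (V.dualVec I i ⬝ᵥ v) := by
      rw [V.mem_dualConePos_iff hIf hKI, and_iff_right hA]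
      refine forall₂_congr fun i hi => ?_
      have h1 := hm0 i (Finset.mem_sdiff.1 hi).2
      have h2 := hv I hI i hi
      have h3 : m i = u ⬝ᵥ latVec (V.vec i) - d i := rfl
      rcases h2.lt_or_gt with h | h
      · rw [mul_pos_iff_neg_of_neg h]
        simp only [h.not_gt, false_imp_iff, not_false_eq_true, true_imp_iff, true_and]
        rw [← sub_nonpos, ← h3]
        exact ⟨fun h => lt_of_le_of_ne h h1, le_of_lt⟩
      · rw [mul_pos_iff_of_pos_right h]
        simp only [h, not_true_eq_false, false_imp_iff, true_imp_iff, and_true]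
        rw [← sub_nonneg, ← h3]
        exact ⟨fun h => lt_of_le_of_ne h h1.symm, le_of_lt⟩
    -- When u is in the cone, m_i and ⟨u_i^I, v⟩ have equal signs, so the sign attached to I can be
    -- written with the m_i alone, without v.
    have hsign : (if u ∈ V.dualConePos K d v I then V.signAt K v I * Δ.w I else 0) =
        Δ.w I * (∏ i ∈ I \ K, -(SignType.sign (m i) : ℤ)) *
          if ∀ i ∈ I \ K, 0 < m i * (V.dualVec I i ⬝ᵥ v) then 1 else 0 := by
      rw [if_congr hmem rfl rfl]
      split_ifs with h
      · rw [mul_one, mul_comm]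
        congr 1
        rw [signAt, ← Finset.prod_const, Finset.prod_filter]
        refine Finset.prod_congr rfl fun i hi => ?_
        have h1 := h i hi
        rcases (hv I hI i hi).lt_or_gt with h2 | h2
        · rw [if_neg h2.not_gt, sign_neg ((mul_pos_iff_neg_of_neg h2).1 h1)]; simp
        · rw [if_pos h2, sign_pos ((mul_pos_iff_of_pos_right h2).1 h1)]; simp
      · simp
    rw [hsign, ray_crossing_identity (I \ K) (fun i => m i * (V.dualVec I i ⬝ᵥ v)) (fun i => m i * (V.dualVec I i ⬝ᵥ p)),
      Finset.mul_sum]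
    · refine Finset.sum_congr rfl fun i hi => ?_
      simp only [hPr_iff I hI i hi]
      have h1 : I.erase i \ K = (I \ K).erase i := by
        ext j; simp only [Finset.mem_sdiff, Finset.mem_erase]; tauto
      rw [h1, ← Finset.mul_prod_erase _ _ hi, sign_mul]
      have h2 : (SignType.sign (m i) : ℤ) * (SignType.sign (m i) : ℤ) = 1 := by
        rcases (hm0 i (Finset.mem_sdiff.1 hi).2).lt_or_gt with h | h
        · rw [sign_neg h]; rfl
        · rw [sign_pos h]; rfl
      rw [SignType.coe_mul]
      linear_combination (-(Δ.w I) * (∏ j ∈ (I \ K).erase i, -(SignType.sign (m j) : ℤ)) *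
        (SignType.sign (V.dualVec I i ⬝ᵥ p) : ℤ) * (if Pr (I.erase i) then 1 else 0)) * h2
    · exact fun i hi => mul_ne_zero (hm0 i (Finset.mem_sdiff.1 hi).2) (hv I hI i hi)
    · exact fun i hi => mul_ne_zero (hm0 i (Finset.mem_sdiff.1 hi).2)
        (hb I hI i (Finset.mem_sdiff.1 hi).1)
    · intro i hi j hj hij
      have := mul_ne_zero (mul_ne_zero (hm0 i (Finset.mem_sdiff.1 hi).2)
        (hm0 j (Finset.mem_sdiff.1 hj).2)) (hab I hI i hi j hj hij)
      intro h
      apply this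
      linear_combination h
    -- The ray must leave the cone: otherwise every term of (u − u_I)·p = ∑ m_i ⟨u_i^I, p⟩ would be
    -- at most zero, against the separation hypothesis.
    · by_contra! hneg
      have h1 := hp2 I (hy I hI)
      have h2 : (u - V.vertexPt d I) ⬝ᵥ p = ∑ i ∈ I, m i * (V.dualVec I i ⬝ᵥ p) := by
        conv_lhs => rw [← V.sum_smul_dualVec hIf (u - V.vertexPt d I), sum_dotProduct]
        refine Finset.sum_congr rfl fun i hi => ?_
        rw [sub_dotProduct, V.vertexPt_dotProduct hIf d hi, smul_dotProduct, smul_eq_mul]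
      rw [h2, ← Finset.sum_sdiff hKI, Finset.sum_eq_zero (s := K), add_zero] at h1
      · exact absurd h1 (not_lt.2 (Finset.sum_nonpos hneg))
      · intro i hi
        simp [hm, hA i hi]
  rw [DH, Finset.sum_congr rfl hterm,
    sum_facetsAt_erase (fun J => -(∏ j ∈ J \ K, -(SignType.sign (m j) : ℤ)) *
        if Pr J then 1 else 0) (fun I i => Δ.w I * (SignType.sign (V.dualVec I i ⬝ᵥ p) : ℤ))]
  refine Finset.sum_eq_zero fun J hJ => ?_
  obtain ⟨hJf, hKJ, hJc⟩ := Finset.mem_filter.1 hJ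
  rw [V.sum_sign_eq_zero hJf hJc (hΔ J hJf), mul_zero]
  intro hspan
  obtain ⟨I, hI, hJI, hIc⟩ := Δ.exists_facet J hJf
  have hIf := mem_facets.2 ⟨hI, hIc⟩
  obtain ⟨i, hiI, hiJ⟩ : ∃ i ∈ I, i ∉ J := by
    by_contra! h
    have := Finset.card_le_card h
    omega
  exact hb I (mem_facetsAt.2 ⟨hIf, hKJ.trans hJI⟩) i hiI
    (V.dualVec_dotProduct_of_mem_span hIf hJI hiI hiJ hspan)

/-- A point where the Duistermaat–Heckman function does not vanish satisfies the equations of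
`A_K^*`. -/
theorem mem_aff_of_DH_ne_zero {K : Finset ι} {v : Fin n → ℝ} {d : ι → ℝ} {u : Fin n → ℝ}
    (h : V.DH K d v u ≠ 0) : ∀ i ∈ K, u ⬝ᵥ latVec (V.vec i) = d i := by
  obtain ⟨I, hI, h1⟩ := Finset.exists_ne_zero_of_sum_ne_zero h
  obtain ⟨hIf, hKI⟩ := mem_facetsAt.1 hI
  by_cases hu : u ∈ V.dualConePos K d v I
  · exact ((V.mem_dualConePos_iff hIf hKI d v u).1 hu).1
  · simp [hu] at h1

/-- Completing the square, the inequality describes the closed ball of centre x/2 with 0 on its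
boundary. -/
theorem finite_latVec_le {n : ℕ} (x : Fin n → ℝ) :
    {u : Fin n → ℤ | latVec u ⬝ᵥ latVec u ≤ x ⬝ᵥ latVec u}.Finite := by
  set B : ℤ := ⌈x ⬝ᵥ x + 1⌉
  refine (Set.Finite.pi (fun _ : Fin n => Set.finite_Icc (-B) B)).subset ?_
  intro u hu
  rw [Set.mem_univ_pi]
  intro j
  have h1 : ∑ k, (latVec u k - x k / 2) ^ 2 ≤ x ⬝ᵥ x / 4 := by
    have : ∑ k, (latVec u k - x k / 2) ^ 2 =
        latVec u ⬝ᵥ latVec u - x ⬝ᵥ latVec u + x ⬝ᵥ x / 4 := by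
      simp only [dotProduct, Finset.sum_div, ← Finset.sum_sub_distrib, ← Finset.sum_add_distrib]
      exact Finset.sum_congr rfl fun k _ => by ring
    have hu' : latVec u ⬝ᵥ latVec u ≤ x ⬝ᵥ latVec u := hu
    linarith
  have h2 : (latVec u j - x j / 2) ^ 2 ≤ ∑ k, (latVec u k - x k / 2) ^ 2 :=
    Finset.single_le_sum (f := fun k => (latVec u k - x k / 2) ^ 2) (fun _ _ => sq_nonneg _)
      (Finset.mem_univ j)
  have h3 : x j ^ 2 ≤ x ⬝ᵥ x := by
    have := Finset.single_le_sum (f := fun k => x k * x k) (fun _ _ => mul_self_nonneg _)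
      (Finset.mem_univ j)
    simpa [dotProduct, sq] using this
  have h4 : (B : ℝ) ≥ x ⬝ᵥ x + 1 := Int.le_ceil _
  have h5 : |(u j : ℝ)| ≤ B := by
    have : latVec u j = (u j : ℝ) := rfl
    rw [this] at h2
    rw [abs_le]
    constructor <;> nlinarith [sq_nonneg (x j - 1), sq_nonneg (x j + 1),
      sq_nonneg ((u j : ℝ) - x j / 2 - 1/2), sq_nonneg ((u j : ℝ) - x j / 2 + 1/2)]
  rw [abs_le] at h5
  exact ⟨by exact_mod_cast h5.1, by exact_mod_cast h5.2⟩

/-- If u·u exceeds u_I·u for every vertex u_I, the functional u itself separates u from the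
vertices; the remaining u lie in finitely many balls. -/
theorem finite_support_DH (hΔ : Δ.IsComplete) {K : Finset ι} {v : Fin n → ℝ}
    (hv : V.IsGeneric K v) {d : ι → ℝ}
    (hne : ∀ i, i ∉ K → ∀ k : ℤ, (k : ℝ) ≠ d i) :
    {u : Fin n → ℤ | V.DH K d v (latVec u) ≠ 0}.Finite := by
  refine ((Δ.facetsAt K).finite_toSet.biUnion
    fun I _ => finite_latVec_le (V.vertexPt d I)).subset ?_
  intro u hu
  by_contra hnot
  simp only [Set.mem_iUnion, Set.mem_ofPred_eq, not_exists, not_le] at hnot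
  refine hu (V.DH_eq_zero hΔ hv (fun i hi => ?_) (V.mem_aff_of_DH_ne_zero hu)
    (y := latVec u) fun I hI => ?_)
  · rw [latVec_dotProduct]; exact hne i hi _
  · rw [sub_dotProduct]
    linarith [hnot I hI]

end MultiFan.EdgeVectors

/-! ### The finite groups `G` and their characters. -/

theorem AddCircle.toCircle_sum {T : ℝ} {κ : Type*} (s : Finset κ) (f : κ → AddCircle T) :
    AddCircle.toCircle (∑ i ∈ s, f i) = ∏ i ∈ s, AddCircle.toCircle (f i) := by
  classical
  induction s using Finset.induction_on with
  | empty => simp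
  | insert a s ha ih =>
    rw [Finset.sum_insert ha, Finset.prod_insert ha, AddCircle.toCircle_add, ih]

theorem chiAt_eq_one_iff {ι : Type*} {g : ι → UnitAddCircle} {i : ι} :
    chiAt g i = 1 ↔ g i = 0 := by
  rw [chiAt, Circle.coe_eq_one, ← AddCircle.toCircle_zero]
  exact (AddCircle.injective_toCircle one_ne_zero).eq_iff

theorem exists_int_of_coe_eq_zero {x : ℝ} (h : (x : UnitAddCircle) = 0) : ∃ k : ℤ, x = k := by
  obtain ⟨k, hk⟩ := (AddCircle.coe_eq_zero_iff 1).1 h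
  exact ⟨k, by simpa using hk.symm⟩

theorem coe_int_unitAddCircle (k : ℤ) : ((k : ℝ) : UnitAddCircle) = 0 :=
  (AddCircle.coe_eq_zero_iff 1).2 ⟨k, by simp⟩

theorem coe_sum_unitAddCircle {κ : Type*} (s : Finset κ) (f : κ → ℝ) :
    ((∑ i ∈ s, f i : ℝ) : UnitAddCircle) = ∑ i ∈ s, (f i : UnitAddCircle) :=
  map_sum (QuotientAddGroup.mk' (AddSubgroup.zmultiples (1 : ℝ))) f s

namespace MultiFan.EdgeVectors

variable {ι : Type*} [Fintype ι] [DecidableEq ι] {n : ℕ} {Δ : MultiFan ι n} (V : Δ.EdgeVectors)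

/-- A common denominator of the dual basis vectors `u_i^I`. -/
theorem exists_nsmul_dualVec {I : Finset ι} (hI : I ∈ Δ.facets) :
    ∃ N : ℕ, 0 < N ∧ ∀ i ∈ I, ∃ m : Fin n → ℤ, (N : ℝ) • V.dualVec I i = latVec m := by
  have hcard := (mem_facets.1 hI).2
  let e : Fin n ≃ I := (I.equivFinOfCardEq hcard).symm
  let A : Matrix (Fin n) (Fin n) ℤ := fun k => V.vec (e k)
  have hdual : ∀ w : Fin n → ℤ, latVec w =
      ∑ i ∈ I, ((w ⬝ᵥ V.vec i : ℤ) : ℝ) • V.dualVec I i := by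
    intro w
    conv_lhs => rw [← V.sum_smul_dualVec hI (latVec w)]
    simp only [latVec_dotProduct]
  have hdet : A.det ≠ 0 := by
    intro h0
    obtain ⟨w, hw0, hw⟩ := Matrix.exists_mulVec_eq_zero_iff.2 h0
    apply hw0
    apply latVec_injective
    rw [hdual w, latVec_zero]
    refine Finset.sum_eq_zero fun i hi => ?_
    have h1 := congrFun hw (e.symm ⟨i, hi⟩)
    simp only [Matrix.mulVec, A, Equiv.apply_symm_apply, Pi.zero_apply] at h1
    rw [dotProduct_comm, h1]; simp
  -- Cramer's rule: a column of the adjugate pairs with the v_j to det A times a Kronecker delta; s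
  -- corrects the sign of the determinant.
  refine ⟨A.det.natAbs, Int.natAbs_pos.2 hdet, fun i hi => ?_⟩
  obtain ⟨s, hs⟩ : ∃ s : ℤ, (A.det.natAbs : ℤ) = s * A.det := by
    rcases Int.natAbs_eq A.det with h | h
    · exact ⟨1, by omega⟩
    · exact ⟨-1, by omega⟩
  set w : Fin n → ℤ := fun k => A.adjugate k (e.symm ⟨i, hi⟩) with hw
  have hwd : ∀ j (hj : j ∈ I), w ⬝ᵥ V.vec j = if j = i then A.det else 0 := by
    intro j hj
    have h1 := congrFun (congrFun (Matrix.mul_adjugate A) (e.symm ⟨j, hj⟩)) (e.symm ⟨i, hi⟩)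
    rw [Matrix.mul_apply] at h1
    simp only [A, Equiv.apply_symm_apply, Matrix.smul_apply, Matrix.one_apply,
      EmbeddingLike.apply_eq_iff_eq, Subtype.mk.injEq, smul_eq_mul, mul_ite, mul_one,
      mul_zero] at h1
    rw [dotProduct_comm]
    exact h1
  refine ⟨s • w, ?_⟩
  rw [latVec_smul, hdual w, Finset.sum_eq_single i]
  · rw [hwd i hi, if_pos rfl, smul_smul]
    congr 1
    rw [← Int.cast_natCast, hs, Int.cast_mul]
  · intro j hj hji
    rw [hwd j hj, if_neg hji]; simp
  · intro h; exact absurd hi h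

/-- The homomorphism from `N` to `ℝ^{Σ⁽¹⁾} / ℤ^{Σ⁽¹⁾}` given by the coordinates with respect to
`{v_i}_{i ∈ I}`. -/
def coordHom (V : Δ.EdgeVectors) (I : Finset ι) : (Fin n → ℤ) →+ (ι → UnitAddCircle) where
  toFun z i := if i ∈ I then ((V.dualVec I i ⬝ᵥ latVec z : ℝ) : UnitAddCircle) else 0
  map_zero' := by ext i; simp
  map_add' z z' := by
    ext i
    by_cases hi : i ∈ I <;> simp [hi, latVec_add, dotProduct_add]

theorem coordHom_apply (I : Finset ι) (z : Fin n → ℤ) (i : ι) :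
    V.coordHom I z i = if i ∈ I then ((V.dualVec I i ⬝ᵥ latVec z : ℝ) : UnitAddCircle) else 0 := rfl

theorem range_coordHom {I : Finset ι} (hI : I ∈ Δ.facets) :
    ((V.coordHom I).range : Set (ι → UnitAddCircle)) = V.G I := by
  ext g
  constructor
  · rintro ⟨z, rfl⟩
    refine ⟨fun i => if i ∈ I then V.dualVec I i ⬝ᵥ latVec z else 0, ⟨z, ?_⟩, ?_, ?_⟩
    · conv_rhs => rw [← V.sum_dualVec_smul hI (latVec z)]
      simp only [ite_smul, zero_smul]
      rw [← Finset.sum_filter]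
      congr 1
      ext; simp
    · intro j hj; simp [hj]
    · ext i
      rw [coordHom_apply]
      by_cases hi : i ∈ I <;> simp [hi]
  · rintro ⟨a, ⟨z, hz⟩, ha, rfl⟩
    refine ⟨z, ?_⟩
    ext i
    rw [coordHom_apply]
    split_ifs with hi
    · rw [← hz]
      have h1 : ∑ i, a i • latVec (V.vec i) = ∑ i ∈ I, a i • latVec (V.vec i) := by
        symm
        apply Finset.sum_subset (Finset.subset_univ I)
        intro j _ hj
        rw [ha j hj, zero_smul]
      rw [h1, V.dualVec_dotProduct_sum_smul hI a hi subset_rfl, if_pos hi]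
    · simp [ha i hi]

theorem ker_coordHom {I : Finset ι} (hI : I ∈ Δ.facets) :
    (V.coordHom I).ker = V.edgeLattice I := by
  ext z
  rw [AddMonoidHom.mem_ker]
  constructor
  · intro h
    have h1 : ∀ i ∈ I, ∃ k : ℤ, V.dualVec I i ⬝ᵥ latVec z = k := by
      intro i hi
      have := congrFun h i
      rw [coordHom_apply, if_pos hi] at this
      exact exists_int_of_coe_eq_zero this
    choose! k hk using h1
    have h2 : z = ∑ i ∈ I, k i • V.vec i := by
      apply latVec_injective
      rw [latVec_sum]
      conv_lhs => rw [← V.sum_dualVec_smul hI (latVec z)]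
      refine Finset.sum_congr rfl fun i hi => ?_
      rw [latVec_smul, hk i hi]
    rw [h2]
    exact sum_mem fun i hi =>
      (V.edgeLattice I).zsmul_mem (AddSubgroup.subset_closure (Set.mem_image_of_mem _ hi)) _
  · intro h
    have : V.edgeLattice I ≤ (V.coordHom I).ker := by
      rw [edgeLattice, AddSubgroup.closure_le]
      rintro _ ⟨j, hj, rfl⟩
      rw [SetLike.mem_coe, AddMonoidHom.mem_ker]
      ext i
      rw [coordHom_apply]
      split_ifs with hi
      · rw [V.dualVec_dotProduct hI hi hj]
        split_ifs
        · simp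
        · simp
      · rfl
    exact this h

/-- For a facet N_I is all of N, and coordinates in the basis of edge vectors, taken modulo
integers, have kernel the edge lattice. -/
theorem card_H {I : Finset ι} (hI : I ∈ Δ.facets) :
    Nat.card (V.H I) = Nat.card (V.coordHom I).range := by
  have htop : V.satLattice I = ⊤ := by
    rw [eq_top_iff]
    intro z _
    change latVec z ∈ Submodule.span ℝ (Δ.cone I : Set (Fin n → ℝ))
    rw [V.span_cone (mem_facets.1 hI).1, V.span_vec_eq_top hI]
    trivial
  change ((V.edgeLattice I).addSubgroupOf (V.satLattice I)).index = _
  rw [htop, ← ker_coordHom V hI, ← AddSubgroup.index_ker]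
  change ((V.coordHom I).ker.relIndex ⊤) = _
  exact AddSubgroup.relIndex_top_right _

/-- All coordinates are N-torsion for a common denominator N of the dual basis. -/
theorem finite_G {I : Finset ι} (hI : I ∈ Δ.facets) : (V.G I).Finite := by
  obtain ⟨N, hN, hm⟩ := V.exists_nsmul_dualVec hI
  refine (Set.Finite.pi (fun _ : ι => AddCircle.finite_torsion (1 : ℝ) hN)).subset ?_
  rw [← V.range_coordHom hI]
  rintro _ ⟨z, rfl⟩
  rw [Set.mem_univ_pi]
  intro i
  rw [Set.mem_ofPred_eq, coordHom_apply]
  split_ifs with hi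
  · obtain ⟨m, hm⟩ := hm i hi
    rw [← AddCircle.coe_nsmul, nsmul_eq_mul, ← smul_eq_mul, ← smul_dotProduct, hm,
      latVec_dotProduct]
    exact coe_int_unitAddCircle _
  · simp

theorem finite_GDeltaAt (K : Finset ι) : (V.GDeltaAt K).Finite :=
  (Δ.facetsAt K).finite_toSet.biUnion fun _ hI => V.finite_G (mem_facetsAt.1 hI).1

open Classical in
/-- Orthogonality of characters for `G_I`, whose dual group is the quotient by `M` of the lattice
spanned by the `u_i^I`. -/
theorem sum_prod_chiAt_pow {I : Finset ι} (hI : I ∈ Δ.facets) {S : Finset ι} (hS : S ⊆ I)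
    (k : ι → ℕ) :
    ∑ g ∈ (V.finite_G hI).toFinset, ∏ i ∈ S, chiAt g i ^ k i =
      if ∃ m : Fin n → ℤ, ∑ i ∈ S, (k i : ℝ) • V.dualVec I i = latVec m then
        (Nat.card (V.H I) : ℂ) else 0 := by
  set R := (V.coordHom I).range
  have hR : (R : Set (ι → UnitAddCircle)) = V.G I := V.range_coordHom hI
  have : Finite R := by
    have := V.finite_G hI
    rw [← hR] at this
    exact this
  have : Fintype R := Fintype.ofFinite R
  let ψ : AddChar R ℂ :=
    { toFun := fun g => ∏ i ∈ S, chiAt g.1 i ^ k i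
      map_zero_eq_one' := by simp [chiAt]
      map_add_eq_mul' := fun g h => by
        rw [← Finset.prod_mul_distrib]
        refine Finset.prod_congr rfl fun i _ => ?_
        rw [← mul_pow]
        simp [chiAt, AddCircle.toCircle_add] }
  have h1 : ∑ g ∈ (V.finite_G hI).toFinset, ∏ i ∈ S, chiAt g i ^ k i = ∑ g : R, ψ g := by
    symm
    refine Finset.sum_bij (fun g _ => g.1) (fun g _ => ?_) (fun g _ h _ e => Subtype.ext e)
      (fun g hg => ?_) (fun g _ => rfl)
    · rw [Set.Finite.mem_toFinset, ← hR]; exact g.2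
    · rw [Set.Finite.mem_toFinset, ← hR] at hg
      exact ⟨⟨g, hg⟩, Finset.mem_univ _, rfl⟩
  have hψ : ∀ z : Fin n → ℤ, ψ ⟨V.coordHom I z, z, rfl⟩ = 1 ↔
      ∃ l : ℤ, (∑ i ∈ S, (k i : ℝ) • V.dualVec I i) ⬝ᵥ latVec z = l := by
    intro z
    have h2 : ψ ⟨V.coordHom I z, z, rfl⟩ = (AddCircle.toCircle
        (((∑ i ∈ S, (k i : ℝ) • V.dualVec I i) ⬝ᵥ latVec z : ℝ) : UnitAddCircle) : ℂ) := by
      rw [sum_dotProduct, coe_sum_unitAddCircle, AddCircle.toCircle_sum]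
      change ∏ i ∈ S, chiAt (V.coordHom I z) i ^ k i = _
      refine Eq.trans ?_ (map_prod Circle.coeHom _ _).symm
      refine Finset.prod_congr rfl fun i hi => ?_
      change _ = ((AddCircle.toCircle _ : Circle) : ℂ)
      rw [chiAt, coordHom_apply, if_pos (hS hi), smul_dotProduct, smul_eq_mul, ← nsmul_eq_mul,
        AddCircle.coe_nsmul, AddCircle.toCircle_nsmul, Circle.coe_pow]
    rw [h2, Circle.coe_eq_one, ← AddCircle.toCircle_zero (T := 1),
      (AddCircle.injective_toCircle one_ne_zero).eq_iff]
    constructor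
    · exact exists_int_of_coe_eq_zero
    · rintro ⟨l, hl⟩
      rw [hl]; exact coe_int_unitAddCircle l
  -- In additive notation 0 is the trivial character; triviality means that the exponent pairs
  -- integrally with all of N, that is, lies in M.
  have h3 : ψ = 0 ↔ ∃ m : Fin n → ℤ, ∑ i ∈ S, (k i : ℝ) • V.dualVec I i = latVec m := by
    constructor
    · intro h
      have h4 : ∀ z : Fin n → ℤ,
          ∃ l : ℤ, (∑ i ∈ S, (k i : ℝ) • V.dualVec I i) ⬝ᵥ latVec z = l := by
        intro z
        rw [← hψ, h, AddChar.zero_apply]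
      choose l hl using h4
      refine ⟨fun j => l (Pi.single j 1), ?_⟩
      ext j
      have := hl (Pi.single j 1)
      have e : latVec (Pi.single j 1 : Fin n → ℤ) = Pi.single j 1 := by
        ext i
        simp [latVec, Pi.single_apply]
      rw [e, dotProduct_single_one] at this
      exact this
    · rintro ⟨m, hm⟩
      ext ⟨_, z, rfl⟩
      rw [AddChar.zero_apply, hψ, hm]
      exact ⟨m ⬝ᵥ z, latVec_dotProduct m z⟩
  rw [h1, AddChar.sum_eq_ite, if_congr h3 rfl rfl, V.card_H hI, Nat.card_eq_fintype_card]

theorem card_H_ne_zero {I : Finset ι} (hI : I ∈ Δ.facets) : Nat.card (V.H I) ≠ 0 := by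
  rw [V.card_H hI]
  have : Finite (V.coordHom I).range := by
    have := V.finite_G hI
    rw [← V.range_coordHom hI] at this
    exact this
  exact Nat.card_pos.ne'

theorem chiAt_pow_eq_one {I : Finset ι} (hI : I ∈ Δ.facets) {N : ℕ}
    (hN : ∀ i ∈ I, ∃ m : Fin n → ℤ, (N : ℝ) • V.dualVec I i = latVec m)
    {g : ι → UnitAddCircle} (hg : g ∈ V.G I) {i : ι} (hi : i ∈ I) : chiAt g i ^ N = 1 := by
  rw [← V.range_coordHom hI] at hg
  obtain ⟨z, rfl⟩ := hg
  rw [chiAt, ← Circle.coe_pow, ← AddCircle.toCircle_nsmul, coordHom_apply, if_pos hi]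
  obtain ⟨m, hm⟩ := hN i hi
  rw [← AddCircle.coe_nsmul, nsmul_eq_mul, ← smul_eq_mul, ← smul_dotProduct, hm,
    latVec_dotProduct, coe_int_unitAddCircle]
  simp

/-! ### Restriction to a fixed point -/

theorem restrict_toHT {I : Finset ι} (hI : I ∈ Δ.facets) (f : MvPowerSeries ι ℂ) :
    V.restrict I hI (Δ.toHT f) = MvPowerSeries.subst (V.restrictGen I) f := by
  change MvPowerSeries.substAlgHom (V.hasSubst_restrictGen I) f = _
  rw [MvPowerSeries.coe_substAlgHom]

theorem restrict_X {I : Finset ι} (hI : I ∈ Δ.facets) (i : ι) :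
    V.restrict I hI (Δ.toHT (MvPowerSeries.X i)) = V.restrictGen I i := by
  rw [restrict_toHT, MvPowerSeries.subst_X (V.hasSubst_restrictGen I)]

theorem restrict_subst_X {I : Finset ι} (hI : I ∈ Δ.facets) (i : ι) (f : PowerSeries ℂ) :
    V.restrict I hI (Δ.toHT (PowerSeries.subst (MvPowerSeries.X i : MvPowerSeries ι ℂ) f)) =
      if i ∈ I then PowerSeries.subst (linForm (V.dualVec I i)) f
      else MvPowerSeries.C (PowerSeries.constantCoeff f) := by
  rw [restrict_toHT]
  have h : MvPowerSeries.subst (V.restrictGen I)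
      (PowerSeries.subst (MvPowerSeries.X i : MvPowerSeries ι ℂ) f) =
      PowerSeries.subst (V.restrictGen I i) f := by
    unfold PowerSeries.subst
    rw [MvPowerSeries.subst_comp_subst_apply (PowerSeries.HasSubst.X i).const
      (V.hasSubst_restrictGen I)]
    congr 1
    ext1
    rw [MvPowerSeries.subst_X (V.hasSubst_restrictGen I)]
  rw [h, restrictGen]
  split_ifs
  · rfl
  · rw [PowerSeries.subst_zero_eq_C_constantCoeff]
    simp

theorem restrict_xK {I K : Finset ι} (hI : I ∈ Δ.facets) (hK : K ⊆ I) :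
    V.restrict I hI (Δ.xK K) = ∏ i ∈ K, linForm (V.dualVec I i) := by
  rw [xK, map_prod]
  refine Finset.prod_congr rfl fun i hi => ?_
  rw [restrict_X, restrictGen, if_pos (hK hi)]

theorem restrict_xK_of_not_subset {I K : Finset ι} (hI : I ∈ Δ.facets) (hK : ¬ K ⊆ I) :
    V.restrict I hI (Δ.xK K) = 0 := by
  obtain ⟨i, hiK, hiI⟩ := Finset.not_subset.1 hK
  rw [xK, map_prod]
  refine Finset.prod_eq_zero hiK ?_
  rw [restrict_X, restrictGen, if_neg hiI]

theorem restrict_expXi {I : Finset ι} (hI : I ∈ Δ.facets) (d : ι → ℤ) :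
    V.restrict I hI (Δ.expXi d) = expR (V.vertexPt (fun i => (d i : ℝ)) I) := by
  have hs := V.hasSubst_restrictGen I
  have hξ : PowerSeries.HasSubst
      (∑ i, MvPowerSeries.C (d i : ℂ) * MvPowerSeries.X i : MvPowerSeries ι ℂ) :=
    PowerSeries.HasSubst.of_constantCoeff_zero (by simp)
  rw [expXi, restrict_toHT, expR]
  unfold PowerSeries.subst
  rw [MvPowerSeries.subst_comp_subst_apply hξ.const hs]
  congr 1
  ext1
  rw [← MvPowerSeries.coe_substAlgHom hs, map_sum, vertexPt, linForm_sum,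
    ← Finset.sum_subset (Finset.subset_univ I)]
  · refine Finset.sum_congr rfl fun i hi => ?_
    rw [map_mul, MvPowerSeries.coe_substAlgHom, MvPowerSeries.subst_X hs, MvPowerSeries.subst_C,
      restrictGen, if_pos hi, linForm_smul]
    simp
  · intro i _ hi
    rw [map_mul, MvPowerSeries.coe_substAlgHom, MvPowerSeries.subst_X hs, restrictGen, if_neg hi,
      mul_zero]

theorem sdiff_subset_linkVertices {I K : Finset ι} (hI : I ∈ Δ.faces) (hK : K ⊆ I) :
    I \ K ⊆ Δ.linkVertices K := by
  intro i hi
  obtain ⟨hiI, hiK⟩ := Finset.mem_sdiff.1 hi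
  simp only [linkVertices, Finset.mem_filter, Finset.mem_univ, true_and]
  exact ⟨hiK, Δ.down_closed I hI _ (Finset.insert_subset hiI hK)⟩

/-- A representative of g has integral coordinates off I; dropping them changes neither the class
nor the membership of ∑ a_i v_i in N. -/
theorem mem_G_of_mem_GDeltaAt {I K : Finset ι} (hK : K ⊆ I) {g : ι → UnitAddCircle}
    (hg : g ∈ V.GDeltaAt K) (h0 : ∀ i ∈ Δ.linkVertices K, i ∉ I → g i = 0) : g ∈ V.G I := by
  simp only [GDeltaAt, Set.mem_iUnion] at hg
  obtain ⟨J, hJ, a, ⟨z, hz⟩, ha, rfl⟩ := hg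
  obtain ⟨hJf, hKJ⟩ := mem_facetsAt.1 hJ
  have hint : ∀ i, i ∉ I → ∃ k : ℤ, a i = k := by
    intro i hi
    by_cases hiJ : i ∈ J
    · refine exists_int_of_coe_eq_zero (h0 i ?_ hi)
      exact sdiff_subset_linkVertices (mem_facets.1 hJf).1 hKJ
        (Finset.mem_sdiff.2 ⟨hiJ, fun h => hi (hK h)⟩)
    · exact ⟨0, by simpa using ha i hiJ⟩
  choose! k hk using hint
  refine ⟨fun i => if i ∈ I then a i else 0,
    ⟨z - ∑ i ∈ Finset.univ \ I, k i • V.vec i, ?_⟩, fun j hj => if_neg hj, ?_⟩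
  · rw [sub_eq_add_neg, latVec_add, latVec_neg, latVec_sum, ← hz,
      ← Finset.sum_sdiff (f := fun i => a i • latVec (V.vec i)) (Finset.subset_univ I)]
    have h1 : ∑ i ∈ Finset.univ \ I, a i • latVec (V.vec i) =
        ∑ i ∈ Finset.univ \ I, latVec (k i • V.vec i) := by
      refine Finset.sum_congr rfl fun i hi => ?_
      rw [latVec_smul, hk i (Finset.mem_sdiff.1 hi).2]
    rw [h1, add_neg_cancel_comm]
    simp only [ite_smul, zero_smul]
    rw [← Finset.sum_filter]
    congr 1
    ext; simp
  · ext i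
    by_cases hi : i ∈ I
    · simp [hi]
    · simp only [hi, if_false, hk i hi, coe_int_unitAddCircle]
      simp

/-- A factor at a vertex off I restricts to its constant term, which is 1 if χ_i(g) = 1 and 0
otherwise. Hence exactly the g in G_I survive. -/
theorem restrict_toddClassAt {I K : Finset ι} (hI : I ∈ Δ.facets) (hK : K ⊆ I) :
    V.restrict I hI (V.toddClassAt K) = ∑ g ∈ (V.finite_G hI).toFinset,
      ∏ i ∈ I \ K, PowerSeries.subst (linForm (V.dualVec I i)) (toddSeries (chiAt g i)) := by
  classical
  have hlink := sdiff_subset_linkVertices (mem_facets.1 hI).1 hK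
  rw [toddClassAt, finsum_mem_eq_finite_toFinset_sum _ (V.finite_GDeltaAt K), map_sum]
  simp only [map_prod, restrict_subst_X]
  rw [← Finset.sum_subset (s₁ := (V.finite_G hI).toFinset)]
  · refine Finset.sum_congr rfl fun g hg => ?_
    rw [Set.Finite.mem_toFinset] at hg
    rw [← Finset.prod_subset hlink]
    · refine Finset.prod_congr rfl fun i hi => ?_
      rw [if_pos (Finset.mem_sdiff.1 hi).1]
    · intro i hi hiI
      have hiK : i ∉ K := (Finset.mem_filter.1 hi).2.1
      have hiI' : i ∉ I := fun h => hiI (Finset.mem_sdiff.2 ⟨h, hiK⟩)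
      obtain ⟨a, -, ha, rfl⟩ := hg
      have h1 : chiAt (fun i => (a i : UnitAddCircle)) i = 1 := by
        rw [chiAt_eq_one_iff, ha i hiI']; simp
      rw [if_neg hiI', h1, constantCoeff_toddSeries_one, map_one]
  · intro g hg
    rw [Set.Finite.mem_toFinset] at hg ⊢
    exact Set.mem_biUnion (mem_facetsAt.2 ⟨hI, hK⟩) hg
  · intro g hg hgI
    rw [Set.Finite.mem_toFinset] at hg hgI
    have : ∃ i ∈ Δ.linkVertices K, i ∉ I ∧ g i ≠ 0 := by
      by_contra! h
      exact hgI (V.mem_G_of_mem_GDeltaAt hK hg h)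
    obtain ⟨i, hi, hiI, hgi⟩ := this
    refine Finset.prod_eq_zero hi ?_
    rw [if_neg hiI, constantCoeff_toddSeries_of_ne_one (fun h => hgi (chiAt_eq_one_iff.1 h)),
      map_zero]

open Classical in
/-- The contribution of the fixed point `I` with its denominator cleared: the sum of the `e^u` over
the lattice points of a half-open parallelepiped with vertex `ι_I^*(ξ)`. -/
theorem restrict_mul_prod_one_sub {I K : Finset ι} (hI : I ∈ Δ.facets) (hK : K ⊆ I) (d : ι → ℤ)
    {N : ℕ} (hN : ∀ i ∈ I, ∃ m : Fin n → ℤ, (N : ℝ) • V.dualVec I i = latVec m) :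
    V.restrict I hI (Δ.expXi d * Δ.xK K * V.toddClassAt K) *
        ∏ i ∈ I \ K, (1 - expR (-((N : ℝ) • V.dualVec I i))) =
      (Nat.card (V.H I) : HPt n) * (∏ i ∈ I, linForm (V.dualVec I i)) *
        ∑ k ∈ (Fintype.piFinset fun i => if i ∈ I \ K then Finset.range N else {0}).filter
          (fun k => ∃ m : Fin n → ℤ, ∑ i ∈ I \ K, (k i : ℝ) • V.dualVec I i = latVec m),
          expR (V.vertexPt (fun i => (d i : ℝ)) I - ∑ i ∈ I \ K, (k i : ℝ) • V.dualVec I i) := by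
  rw [map_mul, map_mul, V.restrict_expXi hI, V.restrict_xK hI hK, V.restrict_toddClassAt hI hK]
  have h1 : (∑ g ∈ (V.finite_G hI).toFinset,
      ∏ i ∈ I \ K, PowerSeries.subst (linForm (V.dualVec I i)) (toddSeries (chiAt g i))) *
        ∏ i ∈ I \ K, (1 - expR (-((N : ℝ) • V.dualVec I i))) =
      (∏ i ∈ I \ K, linForm (V.dualVec I i)) * ((Nat.card (V.H I) : HPt n) *
        ∑ k ∈ (Fintype.piFinset fun i => if i ∈ I \ K then Finset.range N else {0}).filter
          (fun k => ∃ m : Fin n → ℤ, ∑ i ∈ I \ K, (k i : ℝ) • V.dualVec I i = latVec m),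
          expR (-∑ i ∈ I \ K, (k i : ℝ) • V.dualVec I i)) := by
    have h2 : ∀ g ∈ (V.finite_G hI).toFinset,
        (∏ i ∈ I \ K, PowerSeries.subst (linForm (V.dualVec I i)) (toddSeries (chiAt g i))) *
        ∏ i ∈ I \ K, (1 - expR (-((N : ℝ) • V.dualVec I i))) =
        (∏ i ∈ I \ K, linForm (V.dualVec I i)) *
        ∑ k ∈ Fintype.piFinset fun i => if i ∈ I \ K then Finset.range N else {0},
          MvPowerSeries.C (∏ i ∈ I \ K, chiAt g i ^ k i) *
            expR (-∑ i ∈ I \ K, (k i : ℝ) • V.dualVec I i) := by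
      intro g hg
      rw [Set.Finite.mem_toFinset] at hg
      -- Allowing only the exponent 0 off I \ K makes the factors there equal to 1, so the product
      -- may run over all vertices before it is expanded.
      have h3 : ∏ i ∈ I \ K, ∑ k ∈ Finset.range N,
            MvPowerSeries.C (chiAt g i ^ k) * expR (-((k : ℝ) • V.dualVec I i)) =
          ∏ i, ∑ k ∈ (if i ∈ I \ K then Finset.range N else {0}),
            MvPowerSeries.C (chiAt g i ^ k) * expR (-((k : ℝ) • V.dualVec I i)) := by
        rw [← Finset.prod_subset (Finset.subset_univ (I \ K))]
        · refine Finset.prod_congr rfl fun i hi => ?_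
          rw [if_pos hi]
        · intro i _ hi
          rw [if_neg hi]; simp
      rw [← Finset.prod_mul_distrib, Finset.prod_congr rfl fun i hi =>
        subst_toddSeries_mul_one_sub (V.chiAt_pow_eq_one hI hN hg (Finset.mem_sdiff.1 hi).1)
          (V.dualVec I i), Finset.prod_mul_distrib, h3, Finset.prod_univ_sum]
      congr 1
      refine Finset.sum_congr rfl fun k hk => ?_
      rw [← Finset.prod_subset (Finset.subset_univ (I \ K)), Finset.prod_mul_distrib, map_prod,
        ← Finset.sum_neg_distrib, expR_sum]
      intro i _ hi
      have : k i = 0 := by simpa [hi] using (Fintype.mem_piFinset.1 hk) i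
      simp [this]
    rw [Finset.sum_mul, Finset.sum_congr rfl h2, ← Finset.mul_sum, Finset.sum_comm]
    congr 1
    rw [Finset.sum_filter, Finset.mul_sum]
    refine Finset.sum_congr rfl fun k _ => ?_
    rw [← Finset.sum_mul, ← map_sum, V.sum_prod_chiAt_pow hI Finset.sdiff_subset k]
    split_ifs <;> simp
  rw [mul_assoc, h1, ← Finset.prod_sdiff hK]
  simp only [sub_eq_add_neg, expR_add, ← Finset.mul_sum]
  ring

end MultiFan.EdgeVectors

/-! ### Difference operators on functions on the lattice -/

/-- The algebra `ℂ[M]` acts on all functions on `M`. -/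
def latticeAction (n : ℕ) :
    AddMonoidAlgebra ℂ (Fin n → ℤ) →ₐ[ℂ] Module.End ℂ ((Fin n → ℤ) → ℂ) :=
  AddMonoidAlgebra.lift ℂ (Module.End ℂ ((Fin n → ℤ) → ℂ)) (Fin n → ℤ)
    { toFun := fun c => LinearMap.funLeft ℂ ℂ fun u => u - c.toAdd
      map_one' := by ext f u; simp [LinearMap.funLeft]
      map_mul' := fun a b => by
        refine LinearMap.ext fun f => funext fun u => ?_
        simp [LinearMap.funLeft, sub_sub] }

theorem latticeAction_single {n : ℕ} (c : Fin n → ℤ) (f : (Fin n → ℤ) → ℂ) (u : Fin n → ℤ) :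
    latticeAction n (AddMonoidAlgebra.single c 1) f u = f (u - c) := by
  rw [latticeAction, AddMonoidAlgebra.lift_single]
  simp [LinearMap.funLeft]

/-- The homomorphism `ℂ[M] → H_T^{**}(pt)` with `u ↦ e^u`. -/
def expHom (n : ℕ) : AddMonoidAlgebra ℂ (Fin n → ℤ) →ₐ[ℂ] HPt n :=
  AddMonoidAlgebra.lift ℂ (HPt n) (Fin n → ℤ)
    { toFun := fun c => expM c.toAdd
      map_one' := by simp [expM_eq_expR]
      map_mul' := fun a b => by simp [expM_eq_expR, latVec_add, expR_add] }

theorem expHom_single {n : ℕ} (c : Fin n → ℤ) :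
    expHom n (AddMonoidAlgebra.single c 1) = expM c := by
  rw [expHom, AddMonoidAlgebra.lift_single, one_smul]
  rfl

/-- The exponential sum `∑_u f(u) e^u` of a finitely supported function. -/
def expSum {n : ℕ} (f : (Fin n → ℤ) → ℂ) : HPt n := ∑ᶠ u, f u • expM u

theorem finite_support_smul_expM {n : ℕ} {f : (Fin n → ℤ) → ℂ} (hf : f.support.Finite) :
    (Function.support fun u => f u • expM u).Finite :=
  hf.subset (Function.support_smul_subset_left f _)

theorem expSum_add {n : ℕ} {f g : (Fin n → ℤ) → ℂ} (hf : f.support.Finite)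
    (hg : g.support.Finite) : expSum (f + g) = expSum f + expSum g := by
  rw [expSum, expSum, expSum,
    ← finsum_add_distrib (finite_support_smul_expM hf) (finite_support_smul_expM hg)]
  simp only [Pi.add_apply, add_smul]

theorem expSum_smul {n : ℕ} (a : ℂ) {f : (Fin n → ℤ) → ℂ} (hf : f.support.Finite) :
    expSum (a • f) = a • expSum f := by
  rw [expSum, expSum, smul_finsum' a (finite_support_smul_expM hf)]
  simp only [Pi.smul_apply, smul_assoc]

theorem expSum_sum {n : ℕ} {κ : Type*} (s : Finset κ) {f : κ → (Fin n → ℤ) → ℂ}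
    (hf : ∀ i ∈ s, (f i).support.Finite) :
    (∑ i ∈ s, f i).support.Finite ∧ expSum (∑ i ∈ s, f i) = ∑ i ∈ s, expSum (f i) := by
  classical
  induction s using Finset.induction_on with
  | empty => simp [expSum]
  | insert a s ha ih =>
    obtain ⟨h1, h2⟩ := ih fun i hi => hf i (Finset.mem_insert_of_mem hi)
    have h3 := hf a (Finset.mem_insert_self a s)
    rw [Finset.sum_insert ha, Finset.sum_insert ha, expSum_add h3 h1, h2]
    exact ⟨(h3.union h1).subset (Function.support_add _ _), rfl⟩

/-- Translating a function by c multiplies its exponential sum by e^c. This is what allows a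
difference equation for functions on M to be read in `HPt`. -/
theorem expSum_latticeAction {n : ℕ} (q : AddMonoidAlgebra ℂ (Fin n → ℤ))
    {f : (Fin n → ℤ) → ℂ} (hf : f.support.Finite) :
    (latticeAction n q f).support.Finite ∧
      expSum (latticeAction n q f) = expHom n q * expSum f := by
  induction q using AddMonoidAlgebra.induction_on with
  | of c =>
    have e : latticeAction n (AddMonoidAlgebra.of ℂ _ (Multiplicative.ofAdd c)) f = fun u => f (u - c) :=
      funext fun u => latticeAction_single c f u
    have e' : expHom n (AddMonoidAlgebra.of ℂ _ (Multiplicative.ofAdd c)) = expM c := expHom_single c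
    rw [e, e']
    constructor
    · exact hf.preimage (sub_left_injective.injOn)
    · rw [expSum, expSum, mul_finsum' _ _ (finite_support_smul_expM hf),
        ← finsum_comp_equiv (Equiv.addRight c)]
      refine finsum_congr fun u => ?_
      simp [expM_eq_expR, latVec_add, expR_add, mul_comm]
  | add p q hp hq =>
    rw [map_add, map_add, LinearMap.add_apply, expSum_add hp.1 hq.1, hp.2, hq.2, add_mul]
    exact ⟨(hp.1.union hq.1).subset (Function.support_add _ _), rfl⟩
  | smul a q hq =>
    rw [map_smul, map_smul, LinearMap.smul_apply, expSum_smul a hq.1, hq.2, smul_mul_assoc]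
    exact ⟨hq.1.subset (Function.support_const_smul_subset a _), rfl⟩

theorem constantCoeff_expSum {n : ℕ} {f : (Fin n → ℤ) → ℂ} (hf : f.support.Finite) :
    MvPowerSeries.constantCoeff (expSum f) = ∑ᶠ u, f u := by
  rw [expSum]
  have h := (MvPowerSeries.constantCoeff (σ := Fin n) (R := ℂ)).toAddMonoidHom.map_finsum
    (finite_support_smul_expM hf)
  refine h.trans (finsum_congr fun u => ?_)
  simp [expM_eq_expR, constantCoeff_expR]

/-! ### From cones to half-open boxes. -/

namespace MultiFan.EdgeVectors

variable {ι : Type*} [Fintype ι] [DecidableEq ι] {n : ℕ} {Δ : MultiFan ι n} (V : Δ.EdgeVectors)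

/-- The function `u ↦ ∏_{i ∈ I} g_i(⟨u, v_i⟩)` on `M`. -/
def prodFun (I : Finset ι) (g : ι → ℤ → ℂ) (u : Fin n → ℤ) : ℂ := ∏ i ∈ I, g i (u ⬝ᵥ V.vec i)

/-- Translation along N u_j^I changes, among the pairings with the v_i for i in I, only that with
v_j, by N; the difference operators thus act on separate factors. -/
theorem latticeAction_prodFun {I : Finset ι} (hI : I ∈ Δ.facets) {N : ℕ} {c : ι → Fin n → ℤ}
    (hc : ∀ i ∈ I, (N : ℝ) • V.dualVec I i = latVec (c i)) (g : ι → ℤ → ℂ) {S : Finset ι}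
    (hS : S ⊆ I) :
    latticeAction n (∏ i ∈ S, (1 - AddMonoidAlgebra.single (-c i) 1)) (V.prodFun I g) =
      V.prodFun I (fun i m => if i ∈ S then g i m - g i (m + N) else g i m) := by
  induction S using Finset.induction_on with
  | empty => simp
  | insert j S hj ih =>
    have hjI := hS (Finset.mem_insert_self j S)
    rw [Finset.prod_insert hj, map_mul, Module.End.mul_apply,
      ih ((Finset.subset_insert j S).trans hS), map_sub, map_one, LinearMap.sub_apply,
      Module.End.one_apply]
    funext u
    rw [Pi.sub_apply, latticeAction_single, sub_neg_eq_add]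
    have hpair : ∀ i ∈ I, (u + c j) ⬝ᵥ V.vec i = u ⬝ᵥ V.vec i + if i = j then (N : ℤ) else 0 := by
      intro i hi
      have h1 : latVec (c j) ⬝ᵥ latVec (V.vec i) = if i = j then (N : ℝ) else 0 := by
        rw [← hc j hjI, smul_dotProduct, V.dualVec_dotProduct hI hjI hi]
        simp
      rw [latVec_dotProduct] at h1
      rw [add_dotProduct]
      congr 1
      split_ifs at h1 ⊢ <;> exact_mod_cast h1
    unfold prodFun
    rw [← Finset.mul_prod_erase _ _ hjI, ← Finset.mul_prod_erase _ _ hjI,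
      ← Finset.mul_prod_erase _ _ hjI, hpair j hjI]
    have h2 : ∏ i ∈ I.erase j, (if i ∈ S then g i ((u + c j) ⬝ᵥ V.vec i) -
        g i ((u + c j) ⬝ᵥ V.vec i + N) else g i ((u + c j) ⬝ᵥ V.vec i)) =
        ∏ i ∈ I.erase j, (if i ∈ S then g i (u ⬝ᵥ V.vec i) -
        g i (u ⬝ᵥ V.vec i + N) else g i (u ⬝ᵥ V.vec i)) := by
      refine Finset.prod_congr rfl fun i hi => ?_
      obtain ⟨hij, hiI⟩ := Finset.mem_erase.1 hi
      rw [hpair i hiI, if_neg hij, add_zero]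
    have h3 : ∏ i ∈ I.erase j, (if i ∈ insert j S then g i (u ⬝ᵥ V.vec i) -
        g i (u ⬝ᵥ V.vec i + N) else g i (u ⬝ᵥ V.vec i)) =
        ∏ i ∈ I.erase j, (if i ∈ S then g i (u ⬝ᵥ V.vec i) -
        g i (u ⬝ᵥ V.vec i + N) else g i (u ⬝ᵥ V.vec i)) := by
      refine Finset.prod_congr rfl fun i hi => ?_
      obtain ⟨hij, hiI⟩ := Finset.mem_erase.1 hi
      simp [hij]
    rw [h2, h3]
    simp only [hj, if_false, if_true, Finset.mem_insert_self]
    ring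

/-- The lattice points of the half-open parallelepiped at the vertex `ι_I^*(ξ)`, as a set. -/
def boxSet (V : Δ.EdgeVectors) (K I : Finset ι) (d : ι → ℤ) (N : ℕ) : Set (Fin n → ℤ) :=
  {u | ∀ i ∈ I, if i ∈ K then u ⬝ᵥ V.vec i = d i
    else d i - N < u ⬝ᵥ V.vec i ∧ u ⬝ᵥ V.vec i ≤ d i}

open Classical in
/-- The contribution of `I` to the Duistermaat–Heckman function, without its weight, at the
points of `M`. -/
theorem ite_signAt_eq_prodFun {K I : Finset ι} (hI : I ∈ Δ.facets) (hK : K ⊆ I) (d : ι → ℤ)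
    {ε : ℝ} (hε0 : 0 < ε) (hε1 : ε < 1) (v : Fin n → ℝ) (u : Fin n → ℤ) :
    (if latVec u ∈ V.dualConePos K (V.shift K d ε) v I then (V.signAt K v I : ℂ) else 0) =
      V.prodFun I (fun i m => if i ∈ K then if m = d i then 1 else 0 else
        if 0 < V.dualVec I i ⬝ᵥ v then if d i < m then -1 else 0
        else if m ≤ d i then 1 else 0) u := by
  -- As 0 < ε < 1, the shift makes one side of the wall strict and the other non-strict at lattice
  -- points.
  have hlt : ∀ k m : ℤ, (k : ℝ) + ε ≤ m ↔ k < m := by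
    intro k m
    constructor
    · intro h
      have : (k : ℝ) < m := by linarith
      exact_mod_cast this
    · intro h
      have : (k : ℝ) + 1 ≤ m := by exact_mod_cast h
      linarith
  have hle : ∀ k m : ℤ, (m : ℝ) ≤ (k : ℝ) + ε ↔ m ≤ k := by
    intro k m
    constructor
    · intro h
      have : (m : ℝ) < k + 1 := by linarith
      have : m < k + 1 := by exact_mod_cast this
      omega
    · intro h
      have : (m : ℝ) ≤ k := by exact_mod_cast h
      linarith
  have hmem : latVec u ∈ V.dualConePos K (V.shift K d ε) v I ↔
      ∀ i ∈ I, if i ∈ K then u ⬝ᵥ V.vec i = d i else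
        if 0 < V.dualVec I i ⬝ᵥ v then d i < u ⬝ᵥ V.vec i else u ⬝ᵥ V.vec i ≤ d i := by
    rw [V.mem_dualConePos_iff hI hK]
    simp only [latVec_dotProduct]
    constructor
    · rintro ⟨h1, h2⟩ i hi
      by_cases hiK : i ∈ K
      · have := h1 i hiK
        simp only [shift, hiK, if_true] at this ⊢
        exact_mod_cast this
      · have := h2 i (Finset.mem_sdiff.2 ⟨hi, hiK⟩)
        simp only [shift, hiK, if_false, hlt, hle] at this ⊢
        split_ifs with h
        · exact this.1 h
        · exact this.2 h
    · intro h
      refine ⟨fun i hi => ?_, fun i hi => ?_⟩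
      · have := h i (hK hi)
        simp only [shift, hi, if_true] at this ⊢
        exact_mod_cast this
      · obtain ⟨hiI, hiK⟩ := Finset.mem_sdiff.1 hi
        have := h i hiI
        simp only [shift, hiK, if_false, hlt, hle] at this ⊢
        constructor <;> intro h' <;> simpa [h'] using this
  rw [if_congr hmem rfl rfl]
  unfold prodFun
  split_ifs with h
  · rw [← Finset.prod_sdiff hK, Finset.prod_eq_one (s := K), mul_one]
    · rw [signAt, ← Finset.prod_const, Finset.prod_filter, Int.cast_prod]
      refine Finset.prod_congr rfl fun i hi => ?_
      obtain ⟨hiI, hiK⟩ := Finset.mem_sdiff.1 hi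
      have := h i hiI
      simp only [hiK, if_false] at this ⊢
      by_cases h' : 0 < V.dualVec I i ⬝ᵥ v
      · simp only [h', if_true] at this ⊢
        rw [if_pos this]; simp
      · simp only [h', if_false] at this ⊢
        rw [if_pos this]; simp
    · intro i hi
      have := h i (hK hi)
      simp only [hi, if_true] at this ⊢
      rw [if_pos this]
  · push Not at h
    obtain ⟨i, hi, h⟩ := h
    symm
    refine Finset.prod_eq_zero hi ?_
    beta_reduce
    split_ifs at h ⊢ <;> rfl

-- The functions 1_{m ≤ d} and −1_{m > d} differ by a constant, so taking f(m) − f(m + N) gives for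
-- both the indicator of d − N < m ≤ d. The dependence on v disappears.
open Classical in
theorem latticeAction_cone {K I : Finset ι} (hI : I ∈ Δ.facets) (d : ι → ℤ) (v : Fin n → ℝ)
    {N : ℕ} {c : ι → Fin n → ℤ} (hc : ∀ i ∈ I, (N : ℝ) • V.dualVec I i = latVec (c i)) :
    latticeAction n (∏ i ∈ I \ K, (1 - AddMonoidAlgebra.single (-c i) 1))
      (V.prodFun I (fun i m => if i ∈ K then if m = d i then 1 else 0 else
        if 0 < V.dualVec I i ⬝ᵥ v then if d i < m then -1 else 0
        else if m ≤ d i then 1 else 0)) = (V.boxSet K I d N).indicator 1 := by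
  rw [V.latticeAction_prodFun hI hc _ Finset.sdiff_subset]
  funext u
  have hfac : ∀ i ∈ I, (if i ∈ I \ K then
      (if i ∈ K then if u ⬝ᵥ V.vec i = d i then (1 : ℂ) else 0 else
        if 0 < V.dualVec I i ⬝ᵥ v then if d i < u ⬝ᵥ V.vec i then -1 else 0
        else if u ⬝ᵥ V.vec i ≤ d i then 1 else 0) -
      (if i ∈ K then if u ⬝ᵥ V.vec i + N = d i then 1 else 0 else
        if 0 < V.dualVec I i ⬝ᵥ v then if d i < u ⬝ᵥ V.vec i + N then -1 else 0
        else if u ⬝ᵥ V.vec i + N ≤ d i then 1 else 0)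
      else (if i ∈ K then if u ⬝ᵥ V.vec i = d i then 1 else 0 else
        if 0 < V.dualVec I i ⬝ᵥ v then if d i < u ⬝ᵥ V.vec i then -1 else 0
        else if u ⬝ᵥ V.vec i ≤ d i then 1 else 0)) =
      if (if i ∈ K then u ⬝ᵥ V.vec i = d i
        else d i - N < u ⬝ᵥ V.vec i ∧ u ⬝ᵥ V.vec i ≤ d i) then 1 else 0 := by
    intro i hi
    by_cases hiK : i ∈ K
    · simp [hiK]
    · have hN : (0 : ℤ) ≤ N := Int.natCast_nonneg N
      simp only [Finset.mem_sdiff, hi, hiK, not_false_eq_true, and_self, if_true, if_false]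
      by_cases hv : 0 < V.dualVec I i ⬝ᵥ v
      · simp only [hv, if_true]
        by_cases h1 : d i < u ⬝ᵥ V.vec i
        · rw [if_pos h1, if_pos (by omega), if_neg (by omega)]; simp
        · by_cases h2 : d i < u ⬝ᵥ V.vec i + N
          · rw [if_neg h1, if_pos h2, if_pos (by omega)]; simp
          · rw [if_neg h1, if_neg h2, if_neg (by omega)]; simp
      · simp only [hv, if_false]
        by_cases h1 : d i < u ⬝ᵥ V.vec i
        · rw [if_neg (by omega), if_neg (by omega), if_neg (by omega)]; simp
        · by_cases h2 : d i < u ⬝ᵥ V.vec i + N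
          · rw [if_pos (by omega), if_neg (by omega), if_pos (by omega)]; simp
          · rw [if_pos (by omega), if_pos (by omega), if_neg (by omega)]; simp
  unfold prodFun
  rw [Finset.prod_congr rfl hfac, Set.indicator_apply, Finset.prod_ite_zero, Finset.prod_const_one]
  by_cases h : u ∈ V.boxSet K I d N
  · rw [if_pos h]; exact if_pos h
  · rw [if_neg h]; exact if_neg h

-- The exponents are k_i = d_i − ⟨u, v_i⟩. Since the vertex lies in M, a point u_I − ∑ k_i u_i^I is
-- in M exactly when ∑ k_i u_i^I is.
open Classical in
theorem bijOn_boxSet {K I : Finset ι} (hI : I ∈ Δ.facets) (hK : K ⊆ I) {d : ι → ℤ}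
    (hd : ∃ m : Fin n → ℤ, V.vertexPt (fun i => (d i : ℝ)) I = latVec m) (N : ℕ) :
    Set.BijOn (fun u i => if i ∈ I \ K then (d i - u ⬝ᵥ V.vec i).toNat else 0)
      (V.boxSet K I d N)
      ((Fintype.piFinset fun i => if i ∈ I \ K then Finset.range N else {0}).filter
          (fun k => ∃ m : Fin n → ℤ, ∑ i ∈ I \ K, (k i : ℝ) • V.dualVec I i = latVec m) :
        Finset (ι → ℕ)) ∧
    ∀ u ∈ V.boxSet K I d N, latVec u = V.vertexPt (fun i => (d i : ℝ)) I - ∑ i ∈ I \ K,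
      (((if i ∈ I \ K then (d i - u ⬝ᵥ V.vec i).toNat else 0 : ℕ) : ℝ)) • V.dualVec I i := by
  obtain ⟨m0, hm0⟩ := hd
  have key : ∀ u ∈ V.boxSet K I d N, latVec u = V.vertexPt (fun i => (d i : ℝ)) I - ∑ i ∈ I \ K,
      (((if i ∈ I \ K then (d i - u ⬝ᵥ V.vec i).toNat else 0 : ℕ) : ℝ)) • V.dualVec I i := by
    intro u hu
    rw [eq_sub_iff_add_eq]
    conv_lhs => rw [← V.sum_smul_dualVec hI (latVec u)]
    rw [vertexPt, ← Finset.sum_sdiff hK, ← Finset.sum_sdiff hK, add_right_comm,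
      ← Finset.sum_add_distrib]
    congr 1
    · refine Finset.sum_congr rfl fun i hi => ?_
      obtain ⟨hiI, hiK⟩ := Finset.mem_sdiff.1 hi
      have h1 := hu i hiI
      rw [if_neg hiK] at h1
      rw [if_pos hi, ← add_smul, latVec_dotProduct]
      congr 1
      have : ((d i - u ⬝ᵥ V.vec i).toNat : ℤ) = d i - u ⬝ᵥ V.vec i := Int.toNat_of_nonneg (by omega)
      rw [← Int.cast_natCast, this]
      push_cast; ring
    · refine Finset.sum_congr rfl fun i hi => ?_
      have h1 := hu i (hK hi)
      rw [if_pos hi] at h1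
      rw [latVec_dotProduct, h1]
  refine ⟨⟨?_, ?_, ?_⟩, key⟩
  · intro u hu
    rw [Finset.mem_coe, Finset.mem_filter, Fintype.mem_piFinset]
    refine ⟨fun i => ?_, m0 - u, ?_⟩
    · by_cases hi : i ∈ I \ K
      · obtain ⟨hiI, hiK⟩ := Finset.mem_sdiff.1 hi
        have h1 := hu i hiI
        rw [if_neg hiK] at h1
        simp only [hi, if_true, Finset.mem_range]
        omega
      · simp only [hi, if_false, Finset.mem_singleton]
    · have h1 := key u hu
      rw [sub_eq_add_neg, latVec_add, latVec_neg, ← hm0, h1]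
      abel
  · intro u hu u' hu' h
    apply latVec_injective
    rw [key u hu, key u' hu']
    have h' := fun i => congrFun h i
    simp only at h'
    simp only [h']
  · intro k hk
    rw [Finset.mem_coe, Finset.mem_filter, Fintype.mem_piFinset] at hk
    obtain ⟨hk, m, hm⟩ := hk
    have hpair : ∀ i ∈ I, (m0 - m) ⬝ᵥ V.vec i = d i - if i ∈ I \ K then (k i : ℤ) else 0 := by
      intro i hi
      have h1 : latVec m ⬝ᵥ latVec (V.vec i) = if i ∈ I \ K then (k i : ℝ) else 0 := by
        have h2 : ∑ i ∈ I \ K, (k i : ℝ) • V.dualVec I i =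
            ∑ i ∈ I, (if i ∈ I \ K then (k i : ℝ) else 0) • V.dualVec I i := by
          simp only [ite_smul, zero_smul]
          rw [← Finset.sum_filter]
          congr 1
          ext j; simp only [Finset.mem_filter, Finset.mem_sdiff]; tauto
        rw [← hm, h2,
          V.sum_smul_dualVec_dotProduct hI (fun i => if i ∈ I \ K then (k i : ℝ) else 0) hi]
      have h3 : latVec m0 ⬝ᵥ latVec (V.vec i) = d i := by
        rw [← hm0, V.vertexPt_dotProduct hI _ hi]
      rw [latVec_dotProduct] at h1 h3
      have h4 : m ⬝ᵥ V.vec i = if i ∈ I \ K then (k i : ℤ) else 0 := by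
        split_ifs at h1 ⊢ <;> exact_mod_cast h1
      have h5 : m0 ⬝ᵥ V.vec i = d i := by exact_mod_cast h3
      rw [sub_dotProduct, h4, h5]
    refine ⟨m0 - m, fun i hi => ?_, ?_⟩
    · rw [hpair i hi]
      by_cases hiK : i ∈ K
      · simp [hiK]
      · have h1 := hk i
        have h2 : i ∈ I \ K := Finset.mem_sdiff.2 ⟨hi, hiK⟩
        rw [if_pos h2, Finset.mem_range] at h1
        rw [if_neg hiK, if_pos h2]
        omega
    · funext i
      by_cases hi : i ∈ I \ K
      · simp only [hi, if_true]
        rw [hpair i (Finset.mem_sdiff.1 hi).1, if_pos hi]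
        simp
      · have h1 := hk i
        rw [if_neg hi, Finset.mem_singleton] at h1
        simp [hi, h1]

/-- The contribution of the fixed point `I` in terms of an exponential sum. -/
theorem restrict_mul_eq_expSum {K I : Finset ι} (hI : I ∈ Δ.facets) (hK : K ⊆ I) {d : ι → ℤ}
    (hd : V.IsTCartier d) {N : ℕ}
    (hN : ∀ i ∈ I, ∃ m : Fin n → ℤ, (N : ℝ) • V.dualVec I i = latVec m) :
    (V.boxSet K I d N).Finite ∧
    V.restrict I hI (Δ.expXi d * Δ.xK K * V.toddClassAt K) *
        ∏ i ∈ I \ K, (1 - expR (-((N : ℝ) • V.dualVec I i))) =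
      (Nat.card (V.H I) : HPt n) * (∏ i ∈ I, linForm (V.dualVec I i)) *
        expSum ((V.boxSet K I d N).indicator 1) := by
  classical
  obtain ⟨hbij, hval⟩ := V.bijOn_boxSet hI hK (hd I hI) N
  refine ⟨hbij.finite_iff_finite.2 (Finset.finite_toSet _), ?_⟩
  rw [V.restrict_mul_prod_one_sub hI hK d hN]
  congr 1
  rw [← finsum_mem_coe_finset, expSum, ← finsum_mem_eq_of_bijOn _ hbij
    (f := fun u => expM u) (fun u hu => by rw [expM_eq_expR, hval u hu]), finsum_mem_def]
  refine finsum_congr fun u => ?_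
  by_cases hu : u ∈ V.boxSet K I d N <;> simp [hu]

/-! ### Comparison of the push-forward with the Duistermaat–Heckman function. -/

/-- The push-forward of the Todd class of `Δ_K` is the exponential sum of the
Duistermaat–Heckman function. -/
theorem push_eq_expSum (hΔ : Δ.IsComplete) {d : ι → ℤ} (hd : V.IsTCartier d) {ε : ℝ}
    (hε0 : 0 < ε) (hε1 : ε < 1) {K : Finset ι} {v : Fin n → ℝ} (hv : V.IsGeneric K v) :
    {u : Fin n → ℤ | V.DH K (V.shift K d ε) v (latVec u) ≠ 0}.Finite ∧
    V.push (Δ.expXi d * Δ.xK K * V.toddClassAt K) =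
      algebraMap (HPt n) (FractionRing (HPt n))
        (expSum fun u => (V.DH K (V.shift K d ε) v (latVec u) : ℂ)) := by
  classical
  -- Off K the shifted coefficients d_i + ε are not integers, so no lattice point lies on a wall.
  have hfin : {u : Fin n → ℤ | V.DH K (V.shift K d ε) v (latVec u) ≠ 0}.Finite := by
    refine V.finite_support_DH hΔ hv fun i hi k hk => ?_
    rw [shift, if_neg hi] at hk
    have h1 : (d i : ℝ) < k := by linarith
    have h2 : (k : ℝ) < d i + 1 := by linarith
    have h3 : d i < k := by exact_mod_cast h1
    have h4 : k < d i + 1 := by exact_mod_cast h2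
    omega
  refine ⟨hfin, ?_⟩
  set D : (Fin n → ℤ) → ℂ := fun u => (V.DH K (V.shift K d ε) v (latVec u) : ℂ) with hD
  have hDfin : D.support.Finite := hfin.subset fun u hu => by simpa [hD] using hu
  have hN : ∀ I ∈ Δ.facetsAt K, ∃ N : ℕ, 0 < N ∧ ∀ i ∈ I,
      ∃ m : Fin n → ℤ, (N : ℝ) • V.dualVec I i = latVec m :=
    fun I hI => V.exists_nsmul_dualVec (mem_facetsAt.1 hI).1
  choose! N hNpos c hc using hN
  set cone : Finset ι → (Fin n → ℤ) → ℂ := fun I u =>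
    if latVec u ∈ V.dualConePos K (V.shift K d ε) v I then (V.signAt K v I : ℂ) else 0 with hcone
  set q : Finset ι → AddMonoidAlgebra ℂ (Fin n → ℤ) := fun I =>
    ∏ i ∈ I \ K, (1 - AddMonoidAlgebra.single (-c I i) 1) with hq
  set box : Finset ι → (Fin n → ℤ) → ℂ := fun I => (V.boxSet K I d (N I)).indicator 1 with hbox
  have hboxfin : ∀ I ∈ Δ.facetsAt K, (box I).support.Finite := fun I hI => by
    obtain ⟨hIf, hKI⟩ := mem_facetsAt.1 hI
    refine (V.restrict_mul_eq_expSum hIf hKI hd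
      (fun i hi => ⟨_, hc I hI i hi⟩)).1.subset Set.support_indicator_subset
  have hDsum : D = ∑ I ∈ Δ.facetsAt K, (Δ.w I : ℂ) • cone I := by
    funext u
    rw [hD, Finset.sum_apply]
    simp only [DH, Int.cast_sum, Pi.smul_apply, hcone, smul_eq_mul]
    refine Finset.sum_congr rfl fun I _ => ?_
    split_ifs
    · push_cast; ring
    · simp
  have hact : ∀ I ∈ Δ.facetsAt K, latticeAction n (q I) (cone I) = box I := by
    intro I hI
    obtain ⟨hIf, hKI⟩ := mem_facetsAt.1 hI
    change _ = (V.boxSet K I d (N I)).indicator 1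
    rw [← V.latticeAction_cone hIf d v (hc I hI)]
    congr 1
    funext u
    exact V.ite_signAt_eq_prodFun hIf hKI d hε0 hε1 v u
  -- The single cone functions may have infinite support, so `expSum` is applied only to D and,
  -- after the operators have acted, to the boxes. The product of all the q I treats every facet at
  -- once.
  have hmain : expHom n (∏ I ∈ Δ.facetsAt K, q I) * expSum D =
      ∑ I ∈ Δ.facetsAt K, (Δ.w I : ℂ) •
        (expHom n (∏ J ∈ (Δ.facetsAt K).erase I, q J) * expSum (box I)) := by
    rw [← (expSum_latticeAction _ hDfin).2, hDsum, map_sum]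
    have h1 : ∀ I ∈ Δ.facetsAt K,
        latticeAction n (∏ J ∈ Δ.facetsAt K, q J) ((Δ.w I : ℂ) • cone I) =
          (Δ.w I : ℂ) • latticeAction n (∏ J ∈ (Δ.facetsAt K).erase I, q J) (box I) := by
      intro I hI
      rw [map_smul, ← Finset.prod_erase_mul _ _ hI, map_mul, Module.End.mul_apply, hact I hI]
    have h2 : ∀ I ∈ Δ.facetsAt K,
        ((Δ.w I : ℂ) • latticeAction n (∏ J ∈ (Δ.facetsAt K).erase I, q J)
          (box I)).support.Finite := fun I hI =>
      (expSum_latticeAction _ (hboxfin I hI)).1.subset (Function.support_const_smul_subset _ _)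
    rw [Finset.sum_congr rfl h1, (expSum_sum _ h2).2]
    refine Finset.sum_congr rfl fun I hI => ?_
    obtain ⟨h3, h4⟩ := expSum_latticeAction (∏ J ∈ (Δ.facetsAt K).erase I, q J) (hboxfin I hI)
    rw [expSum_smul _ h3, h4]
  have hQ : ∀ I ∈ Δ.facetsAt K, expHom n (q I) =
      ∏ i ∈ I \ K, (1 - expR (-((N I : ℝ) • V.dualVec I i))) := by
    intro I hI
    rw [hq, map_prod]
    refine Finset.prod_congr rfl fun i hi => ?_
    rw [map_sub, map_one, expHom_single, expM_eq_expR, latVec_neg,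
      hc I hI i (Finset.mem_sdiff.1 hi).1]
  have hQ0 : ∀ I ∈ Δ.facetsAt K, expHom n (q I) ≠ 0 := by
    intro I hI
    rw [hQ I hI, Finset.prod_ne_zero_iff]
    intro i hi
    refine one_sub_expR_ne_zero (neg_ne_zero.2 (smul_ne_zero ?_
      (V.dualVec_ne_zero (mem_facetsAt.1 hI).1 (Finset.mem_sdiff.1 hi).1)))
    exact_mod_cast (hNpos I hI).ne'
  set alg := algebraMap (HPt n) (FractionRing (HPt n)) with halg
  have hinj : Function.Injective alg := IsFractionRing.injective _ _
  have hterm : V.push (Δ.expXi d * Δ.xK K * V.toddClassAt K) =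
      ∑ I ∈ Δ.facetsAt K, alg ((Δ.w I : HPt n) * expSum (box I)) / alg (expHom n (q I)) := by
    rw [push, facetsAt, Finset.sum_filter,
      Finset.sum_subtype (p := fun I => I ∈ Δ.facets) _ (fun _ => Iff.rfl)]
    refine Finset.sum_congr rfl fun I _ => ?_
    obtain ⟨I, hIf⟩ := I
    split_ifs with hKI
    · have hI := mem_facetsAt.2 ⟨hIf, hKI⟩
      have h1 := (V.restrict_mul_eq_expSum hIf hKI hd (fun i hi => ⟨_, hc I hI i hi⟩)).2
      have h2 : (Nat.card (V.H I) : HPt n) * ∏ i ∈ I, linForm (V.dualVec I i) ≠ 0 := by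
        refine mul_ne_zero ?_ (Finset.prod_ne_zero_iff.2 fun i hi =>
          linForm_ne_zero (V.dualVec_ne_zero hIf hi))
        have h3 : (MvPowerSeries.constantCoeff (Nat.card (V.H I) : HPt n)) ≠ 0 := by
          rw [map_natCast]
          exact_mod_cast V.card_H_ne_zero hIf
        intro h0
        rw [h0, map_zero] at h3
        exact h3 rfl
      rw [div_eq_div_iff ((map_ne_zero_iff alg hinj).2 h2)
        ((map_ne_zero_iff alg hinj).2 (hQ0 I hI)), ← map_mul, ← map_mul]
      congr 1
      rw [hQ I hI, mul_assoc, h1]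
      ring
    -- The factor x_K removes the facets that do not contain K.
    · have h0 : V.restrict I hIf (Δ.expXi d * Δ.xK K * V.toddClassAt K) = 0 := by
        rw [map_mul, map_mul, V.restrict_xK_of_not_subset hIf hKI, mul_zero, zero_mul]
      simp only [h0, mul_zero, map_zero, zero_div]
  have hprod0 : alg (expHom n (∏ I ∈ Δ.facetsAt K, q I)) ≠ 0 := by
    rw [map_ne_zero_iff alg hinj, map_prod, Finset.prod_ne_zero_iff]
    exact hQ0
  refine mul_left_cancel₀ hprod0 ?_
  rw [← map_mul, hmain, hterm, Finset.mul_sum, map_sum]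
  refine Finset.sum_congr rfl fun I hI => ?_
  rw [← Finset.mul_prod_erase _ _ hI, map_mul, map_mul, mul_div_assoc', mul_assoc,
    mul_div_cancel_left₀ _ ((map_ne_zero_iff alg hinj).2 (hQ0 I hI)), ← map_mul]
  congr 1
  rw [Int.cast_smul_eq_zsmul, zsmul_eq_mul]
  ring

theorem pushPt_eq {x : Δ.HT} {f : HPt n}
    (h : V.push x = algebraMap (HPt n) (FractionRing (HPt n)) f) :
    V.pushPt x = MvPowerSeries.constantCoeff f := by
  have hex : ∃ f : HPt n, algebraMap (HPt n) (FractionRing (HPt n)) f = V.push x := ⟨f, h.symm⟩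
  rw [pushPt, dif_pos hex]
  congr 1
  exact IsFractionRing.injective (HPt n) (FractionRing (HPt n)) (hex.choose_spec.trans h)

/-- All the cones lie in A_K^*, where the unshifted d_i, i in K, are prescribed; so restricting the
sum to this affine space loses nothing. -/
theorem finsum_mem_affLattice_DH {A : Type*} [AddCommGroup A] (K : Finset ι) (d : ι → ℤ) (ε : ℝ)
    (v : Fin n → ℝ) (f : (Fin n → ℤ) → ℤ → A) (hf : ∀ u, f u 0 = 0) :
    ∑ᶠ u ∈ V.affLattice K d, f u (V.DH K (V.shift K d ε) v (latVec u)) =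
      ∑ᶠ u, f u (V.DH K (V.shift K d ε) v (latVec u)) := by
  rw [finsum_mem_def, Set.indicator_eq_self.2]
  intro u hu i hi
  have h1 : V.DH K (V.shift K d ε) v (latVec u) ≠ 0 := by
    intro h0
    rw [Function.mem_support, h0, hf] at hu
    exact hu rfl
  have h2 := V.mem_aff_of_DH_ne_zero h1 i hi
  rwa [shift, if_pos hi] at h2

theorem toddClassAt_empty : V.toddClassAt ∅ = V.toddClass := by
  rw [toddClassAt, toddClass, GDeltaAt, GDelta, facetsAt_empty, linkVertices_empty]

end MultiFan.EdgeVectors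

theorem proposition4p2 {ι : Type*} [Fintype ι] [DecidableEq ι] {n : ℕ} (Δ : MultiFan ι n)
    (hΔ : Δ.IsComplete) (V : Δ.EdgeVectors) (d : ι → ℤ) (hd : V.IsTCartier d)
    (ε : ℝ) (hε0 : 0 < ε) (hε1 : ε < 1) :
    (∀ v : Fin n → ℝ, V.IsGeneric ∅ v →
      {u : Fin n → ℤ | V.DH ∅ (fun i => (d i : ℝ) + ε) v (latVec u) ≠ 0}.Finite ∧
      V.push (Δ.expXi d * V.toddClass) =
        algebraMap (HPt n) (FractionRing (HPt n))
          (∑ᶠ u : Fin n → ℤ, V.DH ∅ (fun i => (d i : ℝ) + ε) v (latVec u) • expM u) ∧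
      V.pushPt (Δ.expXi d * V.toddClass) = (V.latticeCount ∅ d ε v : ℂ)) ∧
    (∀ K ∈ Δ.faces, ∀ v : Fin n → ℝ, V.IsGeneric K v →
      {u ∈ V.affLattice K d | V.DH K (V.shift K d ε) v (latVec u) ≠ 0}.Finite ∧
      V.push (Δ.expXi d * Δ.xK K * V.toddClassAt K) =
        algebraMap (HPt n) (FractionRing (HPt n)) (V.latticeSeries K d ε v) ∧
      V.pushPt (Δ.expXi d * Δ.xK K * V.toddClassAt K) = (V.latticeCount K d ε v : ℂ)) := by
  have main : ∀ (K : Finset ι) (v : Fin n → ℝ), V.IsGeneric K v →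
      {u : Fin n → ℤ | V.DH K (V.shift K d ε) v (latVec u) ≠ 0}.Finite ∧
      V.push (Δ.expXi d * Δ.xK K * V.toddClassAt K) =
        algebraMap (HPt n) (FractionRing (HPt n))
          (∑ᶠ u : Fin n → ℤ, V.DH K (V.shift K d ε) v (latVec u) • expM u) ∧
      V.pushPt (Δ.expXi d * Δ.xK K * V.toddClassAt K) = (V.latticeCount K d ε v : ℂ) := by
    intro K v hv
    obtain ⟨hfin, hpush⟩ := V.push_eq_expSum hΔ hd hε0 hε1 hv
    refine ⟨hfin, ?_, ?_⟩
    · rw [hpush, expSum]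
      simp only [Int.cast_smul_eq_zsmul]
    · rw [V.pushPt_eq hpush, constantCoeff_expSum (hfin.subset fun u hu => by simpa using hu),
        MultiFan.EdgeVectors.latticeCount,
        V.finsum_mem_affLattice_DH K d ε v (fun _ m => m) (fun _ => rfl)]
      exact ((Int.castAddHom ℂ).map_finsum hfin).symm
  constructor
  · intro v hv
    have h := main ∅ v hv
    have hshift : V.shift ∅ d ε = fun i => (d i : ℝ) + ε := by
      funext i; simp [MultiFan.EdgeVectors.shift]
    have hx : Δ.xK ∅ = 1 := by simp [MultiFan.xK]
    rwa [hshift, hx, mul_one, V.toddClassAt_empty] at h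
  · intro K _ v hv
    obtain ⟨h1, h2, h3⟩ := main K v hv
    refine ⟨h1.subset fun u hu => hu.2, ?_, h3⟩
    rw [h2, MultiFan.EdgeVectors.latticeSeries,
      V.finsum_mem_affLattice_DH K d ε v (fun u m => m • expM u) (fun _ => zero_smul _ _)]
end
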